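/- Let $P$ be a simple polygon in the plane, regarded as a closed region; its vertices are genuine corners (no straight angles). Two points $x,y\in P$ are line visible to each other if the segment $xy$ is contained in $P$ (it may touch the boundary). A conflict-free chromatic guarding of $P$ with $t$ colors is a finite set $G\subset P$ together with a map $\gamma:G\to\{1,\dots,t\}$ such that every point of $P$ sees at least one guard of $G$ and, among all guards that it sees, at least one has a color carried by no other of them. Let $\chi^l_{cf}(P)$ be the least $t$ for which such a guarding exists and, for a class $\mathcal C$ of polygons, let $\chi^l_{cf}(\mathcal C,n)$ be the supremum of $\chi^l_{cf}(P)$ over all $P\in\mathcal C$ with exactly $n$ vertices. Theorem. There are constants $c>0$ and $n_0$ such that $$\chi^l_{cf}(\mathcal C,n)\ \ge\ c\cdot\frac{\log\log n}{\log\log\log n}$$ for all even $n\ge n_0$ if $\mathcal C$ is the class of simple orthogonal polygons (every edge horizontal or vertical), and for all $n\ge n_0$, even or odd, if $\mathcal C$ is the class of all simple polygons. For even $n\ge n_0$ the bound holds already for the simple orthogonal polygons in general position, that is, those in which, whenever two reflex vertices are connected by a horizontal or vertical chord through the interior, the four rays that prolong their incident edges into the interior represent exactly three of the four compass directions. -/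

import Mathlib

open Filter Topology
open scoped ENNReal

namespace ArtGallery

/-- The plane in Cartesian coordinates (only its affine structure, its topology and its
bounded sets are used below). -/
abbrev Plane : Type := ℝ × ℝ

/-- A polygon, given by its cyclic sequence of vertices, is simple: there are at least three
vertices, each one is a genuine corner (no straight angles), consecutive edges meet only in their
common vertex, and any two other edges are disjoint. Here `finRotate n i` is the cyclic
successor of the index `i`. -/
structure IsSimple {n : ℕ} (p : Polygon Plane n) : Prop where
  three_le : 3 ≤ n
  corner : ∀ i : Fin n,
    ¬ Collinear ℝ {p i, p (finRotate n i), p (finRotate n (finRotate n i))}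
  consecutive : ∀ i : Fin n,
    p.edgeSet ℝ i ∩ p.edgeSet ℝ (finRotate n i) = {p (finRotate n i)}
  disjoint : ∀ i j : Fin n, i ≠ j → j ≠ finRotate n i → i ≠ finRotate n j →
    Disjoint (p.edgeSet ℝ i) (p.edgeSet ℝ j)

/-- Every edge is vertical or horizontal (for a simple polygon the two kinds then alternate,
since there are no straight angles). -/
def IsOrthogonal {n : ℕ} (p : Polygon Plane n) : Prop :=
  ∀ i : Fin n, (p i).1 = (p (finRotate n i)).1 ∨ (p i).2 = (p (finRotate n i)).2

/-- The interior: the points off the boundary curve whose connected component in the complement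
of the curve is bounded. -/
def interiorRegion {n : ℕ} (p : Polygon Plane n) : Set Plane :=
  {x | x ∉ p.boundary ℝ ∧ Bornology.IsBounded (connectedComponentIn (p.boundary ℝ)ᶜ x)}

/-- The polygon as a closed region: the boundary curve together with the interior. -/
def region {n : ℕ} (p : Polygon Plane n) : Set Plane :=
  p.boundary ℝ ∪ interiorRegion p

/-- A vertex of an orthogonal polygon is reflex (interior angle `3π/2`): both incident edges,
prolonged beyond the vertex, enter the interior. -/
def IsReflex {n : ℕ} (p : Polygon Plane n) (i : Fin n) : Prop :=
  ∀ᶠ ε : ℝ in 𝓝[>] 0,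
    p i + ε • (p i - p (finRotate n i)) ∈ interiorRegion p ∧
    p i + ε • (p i - p ((finRotate n).symm i)) ∈ interiorRegion p

/-- The compass direction of an axis-parallel vector. -/
noncomputable def direction (v : Plane) : SignType × SignType :=
  (SignType.sign v.1, SignType.sign v.2)

/-- The directions of the two rays that prolong the edges incident with a vertex. -/
def rayDirections {n : ℕ} (p : Polygon Plane n) (i : Fin n) : Set (SignType × SignType) :=
  {direction (p i - p (finRotate n i)), direction (p i - p ((finRotate n).symm i))}

/-- General position of an orthogonal polygon: whenever two reflex vertices are connected by a
horizontal or vertical chord through the interior, the four rays prolonging their incident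
edges represent exactly three of the four compass directions. -/
def InGeneralPosition {n : ℕ} (p : Polygon Plane n) : Prop :=
  ∀ i j : Fin n, i ≠ j → IsReflex p i → IsReflex p j →
    ((p i).1 = (p j).1 ∨ (p i).2 = (p j).2) →
    openSegment ℝ (p i) (p j) ⊆ interiorRegion p →
    (rayDirections p i ∪ rayDirections p j).ncard = 3

/-- The set of points of `P` that are line visible from `x`. -/
def lineVisibility (P : Set Plane) (x : Plane) : Set Plane :=
  {y | y ∈ P ∧ segment ℝ x y ⊆ P}

/-- `(G, γ)` is a conflict-free chromatic guarding of `P` with colors from `Fin t`, with respect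
to line visibility: `G` is a finite set of points of `P` whose visibility regions cover `P`, and
every point of `P` sees some guard whose color is unique among all guards it sees. -/
structure IsConflictFreeGuarding (P : Set Plane) {t : ℕ} (G : Finset Plane)
    (γ : {g : Plane // g ∈ G} → Fin t) : Prop where
  subset : ∀ g ∈ G, g ∈ P
  cover : (⋃ g ∈ G, lineVisibility P g) = P
  unique : ∀ x ∈ P, ∃ g : {g : Plane // g ∈ G}, g.1 ∈ lineVisibility P x ∧
    ∀ g' : {g : Plane // g ∈ G}, g'.1 ∈ lineVisibility P x → γ g' = γ g → g' = g

/-- The least number of colors in a conflict-free chromatic guarding of `P`. -/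
noncomputable def chiCF (P : Set Plane) : ℕ∞ :=
  ⨅ (t : ℕ) (_ : ∃ (G : Finset Plane) (γ : {g : Plane // g ∈ G} → Fin t),
    IsConflictFreeGuarding P G γ), (t : ℕ∞)

/-- The supremum of `chiCF` over all `n`-vertex polygons of a class of polygons. -/
noncomputable def chiCFMax (C : (n : ℕ) → Set (Polygon Plane n)) (n : ℕ) : ℕ∞ :=
  ⨆ (p : Polygon Plane n) (_ : p ∈ C n), chiCF (region p)

/-- The class of simple polygons. -/
def simplePolygons (n : ℕ) : Set (Polygon Plane n) := {p | IsSimple p}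

/-- The class of simple orthogonal polygons. -/
def simpleOrthogonalPolygons (n : ℕ) : Set (Polygon Plane n) :=
  {p | IsSimple p ∧ IsOrthogonal p}

/-- The class of simple orthogonal polygons in general position. -/
def generalOrthogonalPolygons (n : ℕ) : Set (Polygon Plane n) :=
  {p | IsSimple p ∧ IsOrthogonal p ∧ InGeneralPosition p}

end ArtGallery

/-!
The lower bound comes from a histogram polygon: columns of unit width stand side by side on a
straight base and have such heights that, above `level k i`, the polygon splits into blocks of
level `i`. The blocks form a 4-ary tree of depth `k`, so that about `4 ^ k` vertices are needed.
The row of a block is the part of the block between the heights `level k i` and `level k (i + 1)`.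
The heights grow so fast compared with the width of the polygon that a sight line which passes
through a whole row is almost vertical. A test point lies in the middle gap of a block `w` of level
`b`, at the height of the row of an ancestor `u` of level `a`. It certainly sees the rows of all
blocks on the path from `u` to `w` and all that lies below the row of `u` in its column
(`IsNest.segment_subset`). On the other hand, it sees nothing outside of the zone of `u`, which
consists of the points near the column of `u` below `u` and of the part of the block `u` up to the
top of the rows of level `b + 1` (`IsNest.mem_zone_of_visible`).

These two facts bound the number of colors (`IsNest.false_of_absent`), by induction on the number of
colors that occur in the zone of a block `u`, cut off at a suitable depth. Let `c` be such a color.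
One descends from `u`. If at most one guard of color `c` is certainly visible so far, one of the two
middle children of the current block avoids it. If no guard of color `c` lies in the zone of this
child, one color fewer occurs there, and induction applies. Otherwise one descends to a row with a
new guard of color `c`. Hence after two such steps for each color, the test point at the height of
the row of `u` sees every color that it sees at all at least twice, so that no color is unique.
Each color multiplies the required depth by `O(T)`, so that a guarding with `T` colors is excluded
at depth `O(T) ^ T` (`depth_le`). Since `log n` is about the depth, `log (log n)` is about
`T * log T` (`four_mul_four_pow_le`).

Every histogram is simple (`IsHist.isSimple`), and if its base is horizontal, it is orthogonal and
in general position: a horizontal chord between two reflex vertices joins the right end of a column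
top to the left end of another one. Additional low columns, and, for an odd number of vertices, a
sloping base with one vertex less, realize every number of vertices.
-/

namespace ArtGallery

/-! ### Nested blocks -/

/-- The `i`-th height of a nest of depth `k`. Consecutive heights differ by the factor `8 * 4 ^ k`,
which is large against the total width `4 ^ k` of the nest: a sight line that runs through a whole
row and stays inside a block is almost vertical. -/
noncomputable def level (k i : ℕ) : ℝ := 4 * (8 * 4 ^ k) ^ i

/-- `x` lies in the `q`-th block of level `i` of a nest of depth `k`. The blocks of level `i` are
separated by gaps of width `1`, and each contains exactly four blocks of level `i + 1`, so that
the blocks are the nodes of a 4-ary tree. -/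
def InBlock (k i q : ℕ) (x : ℝ) : Prop :=
  4 ^ (k - i) * (q : ℝ) + 1 ≤ x ∧ x ≤ 4 ^ (k - i) * ((q : ℝ) + 1)

/-- `x` has distance less than `1 / 2` from the `q`-th block of level `i`. -/
def NearBlock (k i q : ℕ) (x : ℝ) : Prop :=
  4 ^ (k - i) * (q : ℝ) + 1 / 2 < x ∧ x < 4 ^ (k - i) * ((q : ℝ) + 1) + 1 / 2

/-- `R` is a nest of depth `k` over the convex set `H`: at the heights above `level k i` the set `R`
lies within the blocks of level `i`, and below `level k (i + 1)` these blocks are bounded only by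
`H`. -/
structure IsNest (k : ℕ) (H R : Set Plane) : Prop where
  convex : Convex ℝ H
  subset : R ⊆ H
  mem_base : ∀ z : Plane, InBlock k 0 0 z.1 → 4 ≤ z.2 → z ∈ H
  nonneg : ∀ z ∈ R, 0 ≤ z.2
  narrow : ∀ z ∈ R, ∀ i < k, level k i < z.2 → ∃ q < 4 ^ i, InBlock k i q z.1
  wide : ∀ z ∈ H, ∀ i q, i + 1 < k → q < 4 ^ i → InBlock k i q z.1 → z.2 ≤ level k (i + 1) → z ∈ R

lemma level_pos (k i : ℕ) : 0 < level k i := by unfold level; positivity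

lemma level_succ (k i : ℕ) : level k (i + 1) = 8 * 4 ^ k * level k i := by
  unfold level; ring

lemma one_le_four_pow (k : ℕ) : (1 : ℝ) ≤ 4 ^ k := one_le_pow₀ (by norm_num)

lemma level_mono (k : ℕ) : Monotone (level k) := by
  apply monotone_nat_of_le_succ
  intro i
  rw [level_succ]
  nlinarith [level_pos k i, one_le_four_pow k]

lemma four_le_level (k i : ℕ) : 4 ≤ level k i := by
  have := level_mono k (Nat.zero_le i)
  simpa [level] using this

/-- Blocks are nested. -/
lemma InBlock.ancestor {k i j q : ℕ} {x : ℝ} (h : InBlock k j q x) (hij : i ≤ j) (hj : j ≤ k) :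
    InBlock k i (q / 4 ^ (j - i)) x := by
  have hd := Nat.div_add_mod q (4 ^ (j - i))
  have hm := Nat.mod_lt q (show 4 ^ (j - i) > 0 by positivity)
  set d := q / 4 ^ (j - i)
  set r := q % 4 ^ (j - i)
  have hp : (4 : ℝ) ^ (k - i) = 4 ^ (k - j) * 4 ^ (j - i) := by
    rw [← pow_add]; congr 1; omega
  have hd' : (4 : ℝ) ^ (j - i) * d + r = q := by exact_mod_cast hd
  have hm' : (r : ℝ) + 1 ≤ 4 ^ (j - i) := by exact_mod_cast hm
  have h4 := one_le_four_pow (k - j)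
  have hr : (0 : ℝ) ≤ r := by positivity
  obtain ⟨h1, h2⟩ := h
  refine ⟨le_trans ?_ h1, h2.trans ?_⟩
  · rw [hp, ← hd']; nlinarith
  · rw [hp, ← hd']; nlinarith

lemma InBlock.unique {k i q r : ℕ} {x : ℝ} (h : InBlock k i q x) (h' : InBlock k i r x) :
    q = r := by
  have h4 := one_le_four_pow (k - i)
  obtain ⟨h1, h2⟩ := h
  obtain ⟨h3, h4⟩ := h'
  by_contra hne
  rcases lt_or_gt_of_ne hne with h | h
  · have : (q : ℝ) + 1 ≤ r := by exact_mod_cast h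
    nlinarith
  · have : (r : ℝ) + 1 ≤ q := by exact_mod_cast h
    nlinarith

/-- The gaps between the blocks of level `i` lie directly to the right of the multiples of
`4 ^ (k - i)`. -/
lemma InBlock.gap {k i q : ℕ} {x : ℝ} (h : InBlock k i q x) (m : ℕ) :
    x ≤ 4 ^ (k - i) * (m : ℝ) ∨ 4 ^ (k - i) * (m : ℝ) + 1 ≤ x := by
  have h4 := one_le_four_pow (k - i)
  obtain ⟨h1, h2⟩ := h
  rcases lt_or_ge q m with h | h
  · left
    have : (q : ℝ) + 1 ≤ m := by exact_mod_cast h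
    nlinarith
  · right
    have : (m : ℝ) ≤ q := by exact_mod_cast h
    nlinarith

lemma InBlock.abs_sub_le {k i q : ℕ} {x y : ℝ} (h : InBlock k i q x) (h' : InBlock k i q y) :
    |x - y| ≤ 4 ^ k := by
  have h4 : (4 : ℝ) ^ (k - i) ≤ 4 ^ k := pow_le_pow_right₀ (by norm_num) (by omega)
  obtain ⟨h1, h2⟩ := h
  obtain ⟨h3, h5⟩ := h'
  rw [abs_le]; constructor <;> nlinarith

lemma InBlock.of_mem_uIcc {k i q : ℕ} {x y z : ℝ} (h : InBlock k i q x) (h' : InBlock k i q y)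
    (hz : z ∈ Set.uIcc x y) : InBlock k i q z := by
  obtain ⟨h1, h2⟩ := h
  obtain ⟨h3, h5⟩ := h'
  obtain ⟨h6, h7⟩ := hz
  exact ⟨(le_min h1 h3).trans h6, h7.trans (max_le h2 h5)⟩

lemma InBlock.near {k i q : ℕ} {x y : ℝ} (h : InBlock k i q x) (hy : |y - x| < 1 / 2) :
    NearBlock k i q y := by
  obtain ⟨h1, h2⟩ := h
  rw [abs_lt] at hy
  exact ⟨by linarith, by linarith⟩

/-- The two middle children of a block are so far from its ends that even the points near them lie
in the block. -/
lemma NearBlock.parent {k i q s : ℕ} {x : ℝ} (hi : i < k) (hs : s = 1 ∨ s = 2)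
    (h : NearBlock k (i + 1) (4 * q + s) x) : InBlock k i q x := by
  have hp : (4 : ℝ) ^ (k - i) = 4 ^ (k - (i + 1)) * 4 := by
    rw [← pow_succ]; congr 1; omega
  have h4 := one_le_four_pow (k - (i + 1))
  obtain ⟨h1, h2⟩ := h
  unfold InBlock
  rw [hp]
  rcases hs with rfl | rfl <;> push_cast at h1 h2 <;> constructor <;> nlinarith

lemma NearBlock.disjoint {k i q : ℕ} {x : ℝ} (h : NearBlock k i (4 * q + 1) x)
    (h' : NearBlock k i (4 * q + 2) x) : False := by
  have h1 := h.2
  have h2 := h'.1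
  push_cast at h1 h2
  nlinarith

/-! ### Sight lines in a nest -/

/-- The point of the segment `zw` at a given height. -/
lemma exists_mem_segment_height {z w : Plane} {h : ℝ} (h1 : z.2 ≤ h) (h2 : h ≤ w.2)
    (hzw : z.2 < w.2) : ∃ p ∈ segment ℝ z w, p.2 = h ∧
      (p.1 - z.1) * (w.2 - z.2) = (w.1 - z.1) * (h - z.2) := by
  have hpos : 0 < w.2 - z.2 := by linarith
  refine ⟨z + ((h - z.2) / (w.2 - z.2)) • (w - z), ?_, ?_, ?_⟩
  · rw [segment_eq_image']
    exact ⟨_, ⟨by apply div_nonneg <;> linarith, by rw [div_le_one hpos]; linarith⟩, rfl⟩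
  · simp; field_simp; ring
  · simp; field_simp

lemma fst_mem_uIcc_of_mem_segment {z w p : Plane} (hp : p ∈ segment ℝ z w) :
    p.1 ∈ Set.uIcc z.1 w.1 := by
  obtain ⟨a, b, ha, hb, hab, rfl⟩ := hp
  have := segment_subset_uIcc z.1 w.1 ⟨a, b, ha, hb, hab, rfl⟩
  simpa using this

lemma snd_mem_uIcc_of_mem_segment {z w p : Plane} (hp : p ∈ segment ℝ z w) :
    p.2 ∈ Set.uIcc z.2 w.2 := by
  obtain ⟨a, b, ha, hb, hab, rfl⟩ := hp
  have := segment_subset_uIcc z.2 w.2 ⟨a, b, ha, hb, hab, rfl⟩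
  simpa using this

/-- A segment in a nest that stays above `level k i` stays in one block of level `i`. -/
lemma IsNest.inBlock_of_segment {k : ℕ} {H R : Set Plane} (hR : IsNest k H R) {i q : ℕ}
    (hi : i < k) {z w : Plane} (hzw : segment ℝ z w ⊆ R) (hz : level k i < z.2)
    (hw : level k i < w.2) (hq : InBlock k i q z.1) : InBlock k i q w.1 := by
  obtain ⟨r, -, hr⟩ := hR.narrow w (hzw (right_mem_segment ℝ z w)) i hi hw
  -- No point of the segment lies in the middle of a gap.
  have key : ∀ m : ℕ, 4 ^ (k - i) * (m : ℝ) + 1 / 2 ∉ Set.uIcc z.1 w.1 := by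
    intro m hm
    rw [← segment_eq_uIcc] at hm
    obtain ⟨a, b, ha, hb, hab, h⟩ := hm
    have hp : a • z + b • w ∈ segment ℝ z w := ⟨a, b, ha, hb, hab, rfl⟩
    have h2 := (snd_mem_uIcc_of_mem_segment hp).1
    obtain ⟨s, -, hs⟩ := hR.narrow _ (hzw hp) i hi ((lt_min hz hw).trans_le h2)
    have h1 : (a • z + b • w).1 = 4 ^ (k - i) * (m : ℝ) + 1 / 2 := by simpa using h
    rw [h1] at hs
    rcases hs.gap m with h | h <;> linarith
  have h4 := one_le_four_pow (k - i)
  rcases lt_trichotomy q r with h | rfl | h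
  · exfalso
    apply key r
    rcases hq.gap r with h' | h'
    · exact Set.mem_uIcc.2 (Or.inl ⟨by linarith, by linarith [hr.1]⟩)
    · have : (q : ℝ) + 1 ≤ r := by exact_mod_cast h
      nlinarith [hq.2]
  · exact hr
  · exfalso
    apply key q
    rcases hr.gap q with h' | h'
    · exact Set.mem_uIcc.2 (Or.inr ⟨by linarith, by linarith [hq.1]⟩)
    · have : (r : ℝ) + 1 ≤ q := by exact_mod_cast h
      nlinarith [hr.2]

/-- The point at height `level k (a + 1)` above the middle gap of the block `q` of level `b`. -/
noncomputable def testPoint (k a b q : ℕ) : Plane :=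
  (4 ^ (k - (b + 1)) * ((4 * q + 2 : ℕ) : ℝ) + 1 / 2, level k (a + 1))

lemma testPoint_inBlock {k b : ℕ} (a q : ℕ) (hb : b < k) :
    InBlock k b q (testPoint k a b q).1 := by
  have hp : (4 : ℝ) ^ (k - b) = 4 ^ (k - (b + 1)) * 4 := by
    rw [← pow_succ]; congr 1; omega
  have h4 := one_le_four_pow (k - (b + 1))
  unfold testPoint InBlock
  rw [hp]
  push_cast
  constructor <;> nlinarith

lemma inBlock_zero {k b q : ℕ} {x : ℝ} (h : InBlock k b q x) (hb : b ≤ k) (hq : q < 4 ^ b) :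
    InBlock k 0 0 x := by
  have := h.ancestor (Nat.zero_le b) hb
  rwa [Nat.sub_zero, Nat.div_eq_of_lt hq] at this

lemma IsNest.testPoint_mem {k : ℕ} {H R : Set Plane} (hR : IsNest k H R) {a b q : ℕ}
    (hab : a ≤ b) (hb : b + 1 < k) (hq : q < 4 ^ b) : testPoint k a b q ∈ R := by
  have h := testPoint_inBlock a q (Nat.lt_of_succ_lt hb)
  exact hR.wide _ (hR.mem_base _ (inBlock_zero h (by omega) hq) (four_le_level _ _)) b q hb hq h
    (level_mono k (by omega))

/-- For `a ≤ i ≤ b`, the test point at height `level k (a + 1)` of a block of level `b` sees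
everything that lies in the vertical strip over the ancestor of level `i` of this block, up to the
top of its row. -/
lemma IsNest.segment_subset {k : ℕ} {H R : Set Plane} (hR : IsNest k H R) {a b q i : ℕ}
    (hai : a ≤ i) (hib : i ≤ b) (hb : b + 1 < k) (hq : q < 4 ^ b) {g : Plane} (hg : g ∈ R)
    (hx : InBlock k i (q / 4 ^ (b - i)) g.1) (hy : g.2 ≤ level k (i + 1)) :
    segment ℝ (testPoint k a b q) g ⊆ R := by
  have h := (testPoint_inBlock a q (Nat.lt_of_succ_lt hb)).ancestor hib (by omega)
  intro p hp
  refine hR.wide p (hR.convex.segment_subset (hR.subset (hR.testPoint_mem (hai.trans hib) hb hq))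
    (hR.subset hg) hp) i _ (by omega) ?_ (h.of_mem_uIcc hx (fst_mem_uIcc_of_mem_segment hp)) ?_
  · rw [Nat.div_lt_iff_lt_mul (by positivity), ← pow_add]
    rwa [Nat.add_sub_cancel' hib]
  · exact (snd_mem_uIcc_of_mem_segment hp).2.trans
      (max_le (level_mono k (by simpa using hai)) hy)

/-- The zone of the block `q` of level `a`, to depth `L`: the points near its column below
`level k a`, and its points in the next `L` rows. -/
def zone (k a q L : ℕ) : Set Plane :=
  {g | (g.2 ≤ level k a ∧ NearBlock k a q g.1) ∨
    (level k a < g.2 ∧ g.2 ≤ level k (a + L) ∧ InBlock k a q g.1)}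

/-- A test point of a block of level `b` sees nothing above `level k (b + 2)`: a sight line has to
leave the middle gap of the block in order to rise above `level k (b + 1)`, so it is too flat to
get through a row of level `b + 1`. -/
lemma IsNest.le_level_of_visible {k : ℕ} {H R : Set Plane} (hR : IsNest k H R) {a b q : ℕ}
    (hab : a ≤ b) (hb : b + 1 < k) (hq : q < 4 ^ b) {g : Plane}
    (hg : segment ℝ (testPoint k a b q) g ⊆ R) : g.2 ≤ level k (b + 2) := by
  by_contra! hlt
  have h4 := one_le_four_pow k
  have hL := level_succ k (b + 1)
  have hpos := level_pos k (b + 1)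
  have hle : level k (a + 1) ≤ level k (b + 1) := level_mono k (by omega)
  have hpa := level_pos k (a + 1)
  have h82 : 8 * level k (b + 1) ≤ level k (b + 2) := by rw [hL]; nlinarith
  obtain ⟨p, hp, hp2, hpe⟩ := exists_mem_segment_height (z := testPoint k a b q) (w := g)
    (h := 2 * level k (b + 1)) (by simp only [testPoint]; linarith) (by linarith)
    (by simp only [testPoint]; linarith)
  obtain ⟨r, -, hr⟩ := hR.narrow p (hg hp) (b + 1) hb (by linarith)
  have hdist : 1 / 2 ≤ |p.1 - (testPoint k a b q).1| := by
    rw [le_abs]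
    simp only [testPoint]
    rcases hr.gap (4 * q + 2) with h | h
    · right; linarith
    · left; linarith
  obtain ⟨s, hs, hs'⟩ := hR.narrow g (hg (right_mem_segment ℝ _ _)) 0 (by omega)
    (by linarith [level_mono k (Nat.zero_le (b + 2))])
  obtain rfl : s = 0 := by simpa using hs
  have hw := hs'.abs_sub_le
    (inBlock_zero (testPoint_inBlock a q (Nat.lt_of_succ_lt hb)) (by omega) hq)
  have habs := congrArg abs hpe
  rw [abs_mul, abs_mul] at habs
  have e1 : |g.2 - (testPoint k a b q).2| = g.2 - level k (a + 1) :=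
    abs_of_pos (by simp only [testPoint]; linarith)
  have e2 : |2 * level k (b + 1) - (testPoint k a b q).2| =
      2 * level k (b + 1) - level k (a + 1) :=
    abs_of_pos (by simp only [testPoint]; linarith)
  rw [e1, e2] at habs
  have i1 : 1 / 2 * (g.2 - level k (a + 1)) ≤
      |p.1 - (testPoint k a b q).1| * (g.2 - level k (a + 1)) :=
    mul_le_mul_of_nonneg_right hdist (by linarith)
  have i2 : |g.1 - (testPoint k a b q).1| * (2 * level k (b + 1) - level k (a + 1)) ≤
      4 ^ k * (2 * level k (b + 1) - level k (a + 1)) :=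
    mul_le_mul_of_nonneg_right hw (by linarith)
  nlinarith

/-- Everything visible from a test point lies in the zone of the block from whose row it looks. -/
lemma IsNest.mem_zone_of_visible {k : ℕ} {H R : Set Plane} (hR : IsNest k H R) {a b q L : ℕ}
    (hab : a ≤ b) (hb : b + 1 < k) (hq : q < 4 ^ b) (hL : b + 2 ≤ a + L) {g : Plane}
    (hg : segment ℝ (testPoint k a b q) g ⊆ R) : g ∈ zone k a (q / 4 ^ (b - a)) L := by
  have h4 := one_le_four_pow k
  have hLa := level_succ k a
  have hpos := level_pos k a
  have h8 : 8 * level k a ≤ level k (a + 1) := by rw [hLa]; nlinarith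
  have hT := (testPoint_inBlock a q (Nat.lt_of_succ_lt hb)).ancestor hab (by omega)
  rcases lt_or_ge (level k a) g.2 with h | h
  · refine Or.inr ⟨h, (hR.le_level_of_visible hab hb hq hg).trans (level_mono k hL), ?_⟩
    exact hR.inBlock_of_segment (by omega) hg (by simp only [testPoint]; linarith) h hT
  · refine Or.inl ⟨h, ?_⟩
    have hg0 := hR.nonneg g (hg (right_mem_segment ℝ _ _))
    -- The sight line is followed down to the height `2 * level k a`, still inside the block.
    obtain ⟨p, hp, hp2, hpe⟩ := exists_mem_segment_height (z := g) (w := testPoint k a b q)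
      (h := 2 * level k a) (by linarith) (by simp only [testPoint]; linarith)
      (by simp only [testPoint]; linarith)
    rw [segment_symm] at hp
    have hpB : InBlock k a (q / 4 ^ (b - a)) p.1 :=
      hR.inBlock_of_segment (by omega)
        (((convex_segment _ _).segment_subset (left_mem_segment ℝ _ _) hp).trans hg)
        (by simp only [testPoint]; linarith) (by linarith) hT
    apply hpB.near
    have hw := hT.abs_sub_le hpB
    have hpe' : ((testPoint k a b q).1 - p.1) * (2 * level k a - g.2) =
        (p.1 - g.1) * (level k (a + 1) - 2 * level k a) := by
      have e : (testPoint k a b q).2 = level k (a + 1) := rfl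
      rw [e] at hpe
      linear_combination -hpe
    have habs := congrArg abs hpe'
    rw [abs_mul, abs_mul, abs_of_nonneg (show 0 ≤ 2 * level k a - g.2 by linarith),
      abs_of_nonneg (show 0 ≤ level k (a + 1) - 2 * level k a by linarith)] at habs
    rw [abs_sub_comm]
    by_contra! hlt
    have i1 : |(testPoint k a b q).1 - p.1| * (2 * level k a - g.2) ≤ 4 ^ k * (2 * level k a) :=
      mul_le_mul hw (by linarith) (by linarith) (by linarith)
    have i2 : 1 / 2 * (level k (a + 1) - 2 * level k a) ≤
        |p.1 - g.1| * (level k (a + 1) - 2 * level k a) :=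
      mul_le_mul_of_nonneg_right hlt (by linarith)
    nlinarith

/-! ### Too few colors in a deep nest -/

/-- The points of `C` that are certainly visible from the test point at height `level k (a + 1)`
of the block `q` of level `b`: those of the rows from `a` to `b` of its column, and those of the
column below. -/
def seen (k : ℕ) (C : Set Plane) (a b q : ℕ) : Set Plane :=
  {g | g ∈ C ∧ ∃ i, a ≤ i ∧ i ≤ b ∧ InBlock k i (q / 4 ^ (b - i)) g.1 ∧ g.2 ≤ level k (i + 1)}

/-- The block `q'` of level `b'` is the block `q` of level `b` or one of its descendants. -/
def Descends (b q b' q' : ℕ) : Prop := b ≤ b' ∧ q' / 4 ^ (b' - b) = q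

lemma Descends.refl (b q : ℕ) : Descends b q b q := ⟨le_rfl, by simp⟩

lemma div_pow_div_pow {a b c q : ℕ} (hab : a ≤ b) (hbc : b ≤ c) :
    q / 4 ^ (c - b) / 4 ^ (b - a) = q / 4 ^ (c - a) := by
  rw [Nat.div_div_eq_div_mul, ← pow_add]; congr 2; omega

lemma Descends.trans {b q b' q' b'' q'' : ℕ} (h : Descends b q b' q')
    (h' : Descends b' q' b'' q'') : Descends b q b'' q'' := by
  obtain ⟨h1, rfl⟩ := h
  obtain ⟨h2, rfl⟩ := h'
  exact ⟨h1.trans h2, (div_pow_div_pow h1 h2).symm⟩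

lemma Descends.child {b q s : ℕ} (hs : s = 1 ∨ s = 2) : Descends b q (b + 1) (4 * q + s) :=
  ⟨by omega, by rw [Nat.add_sub_cancel_left, pow_one]; omega⟩

lemma Descends.of_inBlock {k b q b' q' : ℕ} {x : ℝ} (hb : b ≤ b') (hk : b' ≤ k)
    (h : InBlock k b q x) (h' : InBlock k b' q' x) : Descends b q b' q' :=
  ⟨hb, (h'.ancestor hb hk).unique h⟩

lemma seen_mono {k : ℕ} {C : Set Plane} {a b q b' q' : ℕ} (h : Descends b q b' q') :
    seen k C a b q ⊆ seen k C a b' q' := by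
  rintro g ⟨hg, i, h1, h2, h3, h4⟩
  refine ⟨hg, i, h1, h2.trans h.1, ?_, h4⟩
  rwa [← div_pow_div_pow h2 h.1, h.2]

lemma IsNest.segment_subset_of_mem_seen {k : ℕ} {H R : Set Plane} (hR : IsNest k H R)
    {C : Set Plane} (hC : C ⊆ R) {a b q : ℕ} (hb : b + 1 < k) (hq : q < 4 ^ b)
    {g : Plane} (hg : g ∈ seen k C a b q) : segment ℝ (testPoint k a b q) g ⊆ R := by
  obtain ⟨hg, i, h1, h2, h3, h4⟩ := hg
  exact hR.segment_subset h1 h2 hb hq (hC hg) h3 h4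

lemma zone_subset_zone {k a q L b q' s L' : ℕ} (h : Descends a q b q') (hb : b < k)
    (hs : s = 1 ∨ s = 2) (hL : b + 1 + L' ≤ a + L) :
    zone k (b + 1) (4 * q' + s) L' ⊆ zone k a q L := by
  have hlev : level k (b + 1 + L') ≤ level k (a + L) := level_mono k hL
  have hlev' : level k (b + 1) ≤ level k (a + L) := level_mono k (by omega)
  have up : ∀ x, InBlock k b q' x → InBlock k a q x := fun x hx ↦ by
    have := hx.ancestor h.1 hb.le
    rwa [h.2] at this
  have main : ∀ g : Plane, InBlock k b q' g.1 → g.2 ≤ level k (a + L) → g ∈ zone k a q L := by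
    intro g hx hy
    rcases lt_or_ge (level k a) g.2 with hg | hg
    · exact Or.inr ⟨hg, hy, up _ hx⟩
    · exact Or.inl ⟨hg, (up _ hx).near (by simp)⟩
  rintro g (⟨h1, h2⟩ | ⟨-, h2, h3⟩)
  · exact main g (h2.parent hb hs) (h1.trans hlev')
  · refine main g ?_ (h2.trans hlev)
    have := h3.ancestor (Nat.le_succ b) hb
    rwa [(Descends.child (b := b) (q := q') hs).2] at this

/-- If at most one point of `C` is certainly visible at a block, then one of its two middle
children avoids that point. Either the zone of this child is free of `C`, or one can descend from
it to a row that contains another point of `C`. -/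
lemma IsNest.exists_free_or_new {k : ℕ} {H R : Set Plane} (hR : IsNest k H R)
    {C : Set Plane} (hC : C ⊆ R) {a b q L : ℕ} (hab : a ≤ b) (hbL : b + L < k) (hL : 0 < L)
    (hone : ∀ g ∈ seen k C a b q, ∀ g' ∈ seen k C a b q, g = g') :
    (∃ s, (s = 1 ∨ s = 2) ∧ ∀ g ∈ C, g ∉ zone k (b + 1) (4 * q + s) L) ∨
    ∃ b' q', Descends b q b' q' ∧ b' ≤ b + L ∧ q' < 4 ^ b' ∧
      ∃ g ∈ seen k C a b' q', g ∉ seen k C a b q := by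
  have hb : b < k := by omega
  have mem_seen : ∀ s, (s = 1 ∨ s = 2) → ∀ g ∈ C, g.2 ≤ level k (b + 1) →
      NearBlock k (b + 1) (4 * q + s) g.1 → g ∈ seen k C a b q := fun s hs g hg hy hx ↦
    ⟨hg, b, hab, le_rfl, by simpa using hx.parent hb hs, hy⟩
  obtain ⟨s, hs, hfree⟩ : ∃ s, (s = 1 ∨ s = 2) ∧ ∀ g ∈ C, g.2 ≤ level k (b + 1) →
      ¬ NearBlock k (b + 1) (4 * q + s) g.1 := by
    by_contra! hcon
    obtain ⟨g, hg, hy, hx⟩ := hcon 1 (Or.inl rfl)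
    obtain ⟨g', hg', hy', hx'⟩ := hcon 2 (Or.inr rfl)
    obtain rfl := hone g (mem_seen 1 (Or.inl rfl) g hg hy hx) g'
      (mem_seen 2 (Or.inr rfl) g' hg' hy' hx')
    exact hx.disjoint hx'
  by_cases hz : ∀ g ∈ C, g ∉ zone k (b + 1) (4 * q + s) L
  · exact Or.inl ⟨s, hs, hz⟩
  right
  push Not at hz
  obtain ⟨g, hg, ⟨h1, h2⟩ | ⟨h1, h2, h3⟩⟩ := hz
  · exact absurd h2 (hfree g hg h1)
  -- The row that contains `g`.
  have hex : ∃ i, g.2 ≤ level k (i + 1) :=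
    ⟨b + L, h2.trans (level_mono k (by omega))⟩
  classical
  obtain ⟨i, hi, hmin⟩ : ∃ i, g.2 ≤ level k (i + 1) ∧ level k i < g.2 ∧ b + 1 ≤ i ∧ i ≤ b + L := by
    have hspec := Nat.find_spec hex
    have hlow : b + 1 ≤ Nat.find hex := by
      by_contra! hlt
      exact absurd (hspec.trans (level_mono k (show Nat.find hex + 1 ≤ b + 1 by omega))) h1.not_ge
    refine ⟨Nat.find hex, hspec, ?_, hlow, ?_⟩
    · have := Nat.find_min hex (m := Nat.find hex - 1) (by omega)
      rw [Nat.sub_add_cancel (by omega)] at this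
      exact lt_of_not_ge this
    · exact Nat.find_min' hex (h2.trans (level_mono k (by omega)))
  obtain ⟨hi1, hi2, hi3⟩ := hmin
  obtain ⟨r, hr, hrx⟩ := hR.narrow g (hC hg) i (by omega) hi1
  refine ⟨i, r, (Descends.child hs).trans (Descends.of_inBlock hi2 (by omega) h3 hrx), hi3, hr,
    g, ⟨hg, i, by omega, le_rfl, by simpa using hrx, hi⟩, ?_⟩
  rintro ⟨-, j, -, hj, -, hy⟩
  exact absurd (hy.trans (level_mono k (show j + 1 ≤ b + 1 by omega))) h1.not_ge

/-- From every block one can descend either to the parent of a block whose zone is free of `C`, or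
to a block at which two points of `C` are certainly visible. -/
lemma IsNest.exists_free_or_two {k : ℕ} {H R : Set Plane} (hR : IsNest k H R)
    {C : Set Plane} (hC : C ⊆ R) {a b q L : ℕ} (hab : a ≤ b) (hbL : b + 2 * L < k) (hL : 0 < L)
    (hq : q < 4 ^ b) :
    (∃ b' q' s, Descends b q b' q' ∧ b' ≤ b + L ∧ q' < 4 ^ b' ∧ (s = 1 ∨ s = 2) ∧
      ∀ g ∈ C, g ∉ zone k (b' + 1) (4 * q' + s) L) ∨
    ∃ b' q', Descends b q b' q' ∧ b' ≤ b + 2 * L ∧ q' < 4 ^ b' ∧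
      ∃ g ∈ seen k C a b' q', ∃ g' ∈ seen k C a b' q', g ≠ g' := by
  by_cases h1 : ∀ g ∈ seen k C a b q, ∀ g' ∈ seen k C a b q, g = g'
  swap
  · push Not at h1
    exact Or.inr ⟨b, q, Descends.refl b q, by omega, hq, h1⟩
  obtain ⟨s, hs, hz⟩ | ⟨b', q', hd, hb', hq', g, hg, -⟩ :=
    hR.exists_free_or_new hC hab (by omega) hL h1
  · exact Or.inl ⟨b, q, s, Descends.refl b q, by omega, hq, hs, hz⟩
  by_cases h2 : ∀ g ∈ seen k C a b' q', ∀ g' ∈ seen k C a b' q', g = g'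
  swap
  · push Not at h2
    exact Or.inr ⟨b', q', hd, by omega, hq', h2⟩
  obtain ⟨s, hs, hz⟩ | ⟨b'', q'', hd', hb'', hq'', g', hg', hne⟩ :=
    hR.exists_free_or_new hC (hab.trans hd.1) (by omega) hL h2
  · exact Or.inl ⟨b', q', s, hd, by omega, hq', hs, hz⟩
  · refine Or.inr ⟨b'', q'', hd.trans hd', by omega, hq'', g', hg', g, seen_mono hd' hg, ?_⟩
    rintro rfl
    exact hne hg

/-- The number of levels needed to refute a guarding in which all but `s` of at most `T` colors
are absent. -/
def depth (T : ℕ) : ℕ → ℕ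
  | 0 => 2
  | s + 1 => 2 * T * (depth T s + 1) + 2

lemma depth_pos (T s : ℕ) : 0 < depth T s := by
  cases s <;> simp [depth]

/-- If all but `s` color classes are absent from the zone of a block, to depth `depth T s`, then
some test point sees no color exactly once. For each remaining color, either it is absent from a
zone further down, where the induction hypothesis applies, or the descent reaches a block at which
it is seen twice; a block at which each of the remaining colors is seen twice is impossible. -/
lemma IsNest.false_of_absent {k : ℕ} {H R : Set Plane} (hR : IsNest k H R) {t T : ℕ} (htT : t ≤ T)
    {C : Fin t → Set Plane} (hC : ∀ c, C c ⊆ R)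
    (hu : ∀ x ∈ R, ∃ c, ∃ g ∈ C c, segment ℝ x g ⊆ R ∧
      ∀ g' ∈ C c, segment ℝ x g' ⊆ R → g' = g) (s : ℕ) :
    ∀ (K : Finset (Fin t)) (a q : ℕ), t ≤ K.card + s → q < 4 ^ a → a + depth T s < k →
      (∀ c ∈ K, ∀ g ∈ C c, g ∉ zone k a q (depth T s)) → False := by
  induction s with
  | zero =>
    intro K a q hK hq ha habs
    simp only [depth] at ha habs
    obtain ⟨c, g, hg, hv, -⟩ := hu _ (hR.testPoint_mem le_rfl (by omega) hq)
    have hc : c ∈ K := by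
      have : K = Finset.univ :=
        Finset.eq_univ_of_card K (le_antisymm (Finset.card_le_univ K) (by simpa using hK))
      simp [this]
    refine habs c hc g hg ?_
    simpa using hR.mem_zone_of_visible (L := 2) le_rfl (by omega) hq le_rfl hv
  | succ s ih =>
    intro K a q hK hq ha habs
    have hL := depth_pos T s
    set L := depth T s with hLdef
    have hd : depth T (s + 1) = 2 * T * (L + 1) + 2 := rfl
    have walk : ∀ S : Finset (Fin t), Disjoint S K → ∃ b q', Descends a q b q' ∧
        b ≤ a + S.card * (2 * (L + 1)) ∧ q' < 4 ^ b ∧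
        ∀ c ∈ S, ∃ g ∈ seen k (C c) a b q', ∃ g' ∈ seen k (C c) a b q', g ≠ g' := by
      intro S
      induction S using Finset.induction_on with
      | empty => exact fun _ ↦ ⟨a, q, Descends.refl a q, by omega, hq, by simp⟩
      | insert c S hcS ihS =>
        intro hdis
        rw [Finset.disjoint_insert_left] at hdis
        obtain ⟨b, q₁, hdes, hb, hq₁, htwo⟩ := ihS hdis.2
        rw [Finset.card_insert_of_notMem hcS]
        have hcard : S.card + 1 ≤ T := by
          rw [← Finset.card_insert_of_notMem hcS]
          exact (Finset.card_le_univ _).trans (by simpa using htT)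
        have hbd : (S.card + 1) * (2 * (L + 1)) ≤ 2 * T * (L + 1) := by
          calc (S.card + 1) * (2 * (L + 1)) ≤ T * (2 * (L + 1)) := Nat.mul_le_mul_right _ hcard
            _ = 2 * T * (L + 1) := by ring
        have hexp : (S.card + 1) * (2 * (L + 1)) = S.card * (2 * (L + 1)) + 2 * L + 2 := by ring
        obtain ⟨b', q', u, hd', hb', hq', hu', hz⟩ | ⟨b', q', hd', hb', hq', hg⟩ :=
          hR.exists_free_or_two (hC c) hdes.1 (by omega) hL hq₁
        · exfalso
          refine ih (insert c K) (b' + 1) (4 * q' + u) ?_ ?_ (by omega) ?_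
          · rw [Finset.card_insert_of_notMem hdis.1]; omega
          · rw [pow_succ]; omega
          · intro c' hc' g hg hgz
            rcases Finset.mem_insert.1 hc' with rfl | hc'
            · exact hz g hg hgz
            · exact habs c' hc' g hg
                (zone_subset_zone (hdes.trans hd') (by omega) hu' (by omega) hgz)
        · refine ⟨b', q', hdes.trans hd', by omega, hq', fun c' hc' ↦ ?_⟩
          rcases Finset.mem_insert.1 hc' with rfl | hc'
          · exact hg
          · obtain ⟨g, hg, g', hg', hne⟩ := htwo c' hc'
            exact ⟨g, seen_mono hd' hg, g', seen_mono hd' hg', hne⟩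
    obtain ⟨b, q', hdes, hb, hq', htwo⟩ := walk Kᶜ disjoint_compl_left
    have hbd : Kᶜ.card * (2 * (L + 1)) ≤ 2 * T * (L + 1) := by
      calc Kᶜ.card * (2 * (L + 1)) ≤ T * (2 * (L + 1)) :=
            Nat.mul_le_mul_right _ ((Finset.card_le_univ _).trans (by simpa using htT))
        _ = 2 * T * (L + 1) := by ring
    obtain ⟨c, g, hg, hv, huniq⟩ := hu _ (hR.testPoint_mem hdes.1 (by omega) hq')
    by_cases hc : c ∈ K
    · refine habs c hc g hg ?_
      have := hR.mem_zone_of_visible (L := depth T (s + 1)) hdes.1 (by omega) hq' (by omega) hv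
      rwa [hdes.2] at this
    · obtain ⟨g₁, hg₁, g₂, hg₂, hne⟩ := htwo c (Finset.mem_compl.2 hc)
      apply hne
      rw [huniq g₁ hg₁.1 (hR.segment_subset_of_mem_seen (hC c) (by omega) hq' hg₁),
        huniq g₂ hg₂.1 (hR.segment_subset_of_mem_seen (hC c) (by omega) hq' hg₂)]

/-- A nest of depth more than `depth T T` has no conflict-free guarding with at most `T` colors. -/
theorem IsNest.lt_chiCF {k : ℕ} {H R : Set Plane} (hR : IsNest k H R) {T : ℕ}
    (hk : depth T T < k) : ((T + 1 : ℕ) : ℕ∞) ≤ chiCF R := by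
  refine le_iInf₂ fun t ⟨G, γ, h⟩ ↦ ?_
  by_contra hlt
  have ht : t ≤ T := by
    rw [Nat.cast_le] at hlt; omega
  refine hR.false_of_absent ht (C := fun c ↦ {g | ∃ hg : g ∈ G, γ ⟨g, hg⟩ = c}) ?_ ?_ T ∅ 0 0
    (by simpa using ht) (by simp) (by simpa using hk) (by simp)
  · rintro c g ⟨hg, -⟩
    exact h.subset g hg
  · intro x hx
    obtain ⟨⟨g, hg⟩, hv, hg'⟩ := h.unique x hx
    refine ⟨γ ⟨g, hg⟩, g, ⟨hg, rfl⟩, hv.2, ?_⟩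
    rintro g' ⟨hgG, hγ⟩ hseg
    exact congrArg Subtype.val (hg' ⟨g', hgG⟩ ⟨h.subset _ hgG, hseg⟩ hγ)

/-! ### Histogram polygons -/

/-- The vertices of a histogram: the column over `[j, j + 1]` has height `f j`, and the vertices
number `2 * j` and `2 * j + 1` are the upper ends of its sides. The vertex number `2 * N` is the
right end `(N, f N)` of the base, a further vertex number `2 * N + 1` is the origin. -/
noncomputable def histVertex (N : ℕ) (f : ℕ → ℝ) (m : ℕ) : Plane :=
  if m ≤ 2 * N then ((((m + 1) / 2 : ℕ) : ℝ), f (m / 2)) else (0, 0)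

/-- The polygon with the first `n` vertices of a histogram. With `n = 2 * N + 2` vertices it is
orthogonal; with `n = 2 * N + 1` vertices its base leads from `(N, 0)` to `(0, f 0)`. -/
noncomputable def histPolygon (N : ℕ) (f : ℕ → ℝ) (n : ℕ) : Polygon Plane n :=
  ⟨fun i ↦ histVertex N f i⟩

/-- The conditions under which `N` columns of heights `f 0, …, f (N - 1)` over a straight base from
`(0, ρ)` to `(N, 0)` form a simple polygon with `n` vertices: either the base is horizontal, or it
starts at the top of the first column, which is then lower than all others. -/
structure IsHist (N : ℕ) (f : ℕ → ℝ) (ρ : ℝ) (n : ℕ) : Prop where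
  two_le : 2 ≤ N
  end_eq : f N = 0
  pos : ∀ j < N, 0 < f j
  ne : ∀ j < N, f j ≠ f (j + 1)
  base : (n = 2 * N + 2 ∧ ρ = 0) ∨ (n = 2 * N + 1 ∧ ρ = f 0 ∧ ∀ j < N, 1 ≤ j → f 0 < f j)

/-- The height of the base of a histogram. -/
noncomputable def histBase (N : ℕ) (ρ x : ℝ) : ℝ := ρ * (N - x) / N

/-- The closed region of a histogram. -/
def histRegion (N : ℕ) (f : ℕ → ℝ) (ρ : ℝ) : Set Plane :=
  {z | histBase N ρ z.1 ≤ z.2 ∧ ∃ j < N, (j : ℝ) ≤ z.1 ∧ z.1 ≤ j + 1 ∧ z.2 ≤ f j}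

/-- The open region of a histogram. -/
def histInterior (N : ℕ) (f : ℕ → ℝ) (ρ : ℝ) : Set Plane :=
  {z | 0 < z.1 ∧ z.1 < N ∧ histBase N ρ z.1 < z.2 ∧
    ∀ j < N, (j : ℝ) ≤ z.1 → z.1 ≤ j + 1 → z.2 < f j}

/-- The edges of a histogram as explicit sets. -/
def histEdge (N : ℕ) (f : ℕ → ℝ) (ρ : ℝ) (m : ℕ) : Set Plane :=
  if m < 2 * N then
    if m % 2 = 0 then {z | ((m / 2 : ℕ) : ℝ) ≤ z.1 ∧ z.1 ≤ (m / 2 : ℕ) + 1 ∧ z.2 = f (m / 2)}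
    else {z | z.1 = (m / 2 : ℕ) + 1 ∧ z.2 ∈ Set.uIcc (f (m / 2)) (f (m / 2 + 1))}
  else if m = 2 * N then {z | 0 ≤ z.1 ∧ z.1 ≤ N ∧ z.2 = histBase N ρ z.1}
  else {z | z.1 = 0 ∧ 0 ≤ z.2 ∧ z.2 ≤ f 0}

section

variable {N n : ℕ} {f : ℕ → ℝ} {ρ : ℝ}

lemma histVertex_even {j : ℕ} (hj : j ≤ N) : histVertex N f (2 * j) = ((j : ℝ), f j) := by
  rw [histVertex, if_pos (by omega), show (2 * j + 1) / 2 = j by omega,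
    show 2 * j / 2 = j by omega]

lemma histVertex_odd {j : ℕ} (hj : j < N) : histVertex N f (2 * j + 1) = ((j : ℝ) + 1, f j) := by
  rw [histVertex, if_pos (by omega), show (2 * j + 1 + 1) / 2 = j + 1 by omega,
    show (2 * j + 1) / 2 = j by omega, Nat.cast_add_one]

lemma histVertex_zero : histVertex N f 0 = (0, f 0) := by
  simpa using histVertex_even (N := N) (f := f) (Nat.zero_le N)

lemma histVertex_last : histVertex N f (2 * N + 1) = (0, 0) := by
  rw [histVertex, if_neg (by omega)]

lemma histEdge_even {j : ℕ} (hj : j < N) : histEdge N f ρ (2 * j) =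
    {z : Plane | (j : ℝ) ≤ z.1 ∧ z.1 ≤ (j : ℝ) + 1 ∧ z.2 = f j} := by
  rw [histEdge, if_pos (by omega), if_pos (by omega), show 2 * j / 2 = j by omega]

lemma histEdge_odd {j : ℕ} (hj : j < N) : histEdge N f ρ (2 * j + 1) =
    {z : Plane | z.1 = (j : ℝ) + 1 ∧ z.2 ∈ Set.uIcc (f j) (f (j + 1))} := by
  rw [histEdge, if_pos (by omega), if_neg (by omega), show (2 * j + 1) / 2 = j by omega]

lemma histEdge_base : histEdge N f ρ (2 * N) =
    {z : Plane | 0 ≤ z.1 ∧ z.1 ≤ (N : ℝ) ∧ z.2 = histBase N ρ z.1} := by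
  rw [histEdge, if_neg (by omega), if_pos rfl]

lemma histEdge_last : histEdge N f ρ (2 * N + 1) = {z : Plane | z.1 = 0 ∧ 0 ≤ z.2 ∧ z.2 ≤ f 0} := by
  rw [histEdge, if_neg (by omega), if_neg (by omega)]

lemma histBase_end (N : ℕ) (ρ : ℝ) : histBase N ρ N = 0 := by
  unfold histBase; simp

namespace IsHist

/-- The four kinds of edges: tops of columns, walls, the base, and the left wall that an orthogonal
histogram has below its first column top. -/
lemma cases_index (h : IsHist N f ρ n) {m : ℕ} (hm : m < n) :
    (∃ j < N, m = 2 * j) ∨ (∃ j < N, m = 2 * j + 1) ∨ m = 2 * N ∨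
      (m = 2 * N + 1 ∧ n = 2 * N + 2 ∧ ρ = 0) := by
  rcases Nat.even_or_odd' m with ⟨j, rfl | rfl⟩
  · by_cases hj : j < N
    · exact Or.inl ⟨j, hj, rfl⟩
    · have := h.base
      exact Or.inr (Or.inr (Or.inl (by omega)))
  · by_cases hj : j < N
    · exact Or.inr (Or.inl ⟨j, hj, rfl⟩)
    · rcases h.base with ⟨h1, h2⟩ | ⟨h1, -⟩
      · exact Or.inr (Or.inr (Or.inr ⟨by omega, h1, h2⟩))
      · omega

lemma N_pos (h : IsHist N f ρ n) : (0 : ℝ) < N := by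
  have := h.two_le
  exact_mod_cast (by omega : 0 < N)

lemma base_zero (h : IsHist N f ρ n) : histBase N ρ 0 = ρ := by
  have := h.N_pos
  unfold histBase; field_simp; ring

lemma rho_nonneg (h : IsHist N f ρ n) : 0 ≤ ρ := by
  rcases h.base with ⟨-, h2⟩ | ⟨-, h2, -⟩
  · exact h2.ge
  · rw [h2]; exact (h.pos 0 (by have := h.two_le; omega)).le

lemma rho_le (h : IsHist N f ρ n) {j : ℕ} (hj : j < N) : ρ ≤ f j := by
  rcases h.base with ⟨-, h2⟩ | ⟨-, h2, h3⟩
  · rw [h2]; exact (h.pos j hj).le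
  · rw [h2]
    rcases Nat.eq_zero_or_pos j with rfl | hj'
    · rfl
    · exact (h3 j hj hj').le

lemma base_le_rho (h : IsHist N f ρ n) {x : ℝ} (hx : 0 ≤ x) : histBase N ρ x ≤ ρ := by
  have := h.N_pos
  unfold histBase
  rw [div_le_iff₀ this]
  nlinarith [h.rho_nonneg]

lemma base_nonneg (h : IsHist N f ρ n) {x : ℝ} (hx : x ≤ N) : 0 ≤ histBase N ρ x := by
  have := h.N_pos
  have := h.rho_nonneg
  unfold histBase
  have : 0 ≤ (N : ℝ) - x := by linarith
  positivity

lemma base_lt (h : IsHist N f ρ n) {x : ℝ} (hx : 0 < x) {j : ℕ} (hj : j < N) :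
    histBase N ρ x < f j := by
  have hN := h.N_pos
  rcases h.rho_nonneg.eq_or_lt with h0 | h0
  · have := h.pos j hj
    simpa [histBase, ← h0] using this
  · refine lt_of_lt_of_le ?_ (h.rho_le hj)
    unfold histBase
    rw [div_lt_iff₀ hN]
    nlinarith

lemma eq_zero_of_base (h : IsHist N f ρ n) {x : ℝ} (hx : 0 ≤ x) {j : ℕ} (hj : j < N)
    (he : f j = histBase N ρ x) : x = 0 := by
  by_contra hne
  exact absurd he (h.base_lt (lt_of_le_of_ne hx (Ne.symm hne)) hj).ne'

end IsHist

lemma val_finRotate (i : Fin n) :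
    ((finRotate n i : Fin n) : ℕ) = if (i : ℕ) + 1 = n then 0 else (i : ℕ) + 1 := by
  obtain ⟨m, rfl⟩ := Nat.exists_eq_succ_of_ne_zero i.pos.ne'
  rw [coe_finRotate]
  simp [Fin.ext_iff]

lemma val_finRotate_symm (i : Fin n) :
    (((finRotate n).symm i : Fin n) : ℕ) = if (i : ℕ) = 0 then n - 1 else (i : ℕ) - 1 := by
  have h := val_finRotate ((finRotate n).symm i)
  rw [Equiv.apply_symm_apply] at h
  have := ((finRotate n).symm i).isLt
  split_ifs at h ⊢ <;> omega

lemma segment_horizontal (a b y : ℝ) :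
    segment ℝ ((a, y) : Plane) (b, y) = {z : Plane | z.1 ∈ Set.uIcc a b ∧ z.2 = y} := by
  rw [← Prod.image_mk_segment_left, segment_eq_uIcc]
  ext ⟨u, v⟩
  simp only [Set.mem_image, Prod.mk.injEq, Set.mem_ofPred_eq]
  constructor
  · rintro ⟨x, hx, rfl, rfl⟩; exact ⟨hx, rfl⟩
  · rintro ⟨hx, rfl⟩; exact ⟨u, hx, rfl, rfl⟩

lemma segment_vertical (x a b : ℝ) :
    segment ℝ ((x, a) : Plane) (x, b) = {z : Plane | z.1 = x ∧ z.2 ∈ Set.uIcc a b} := by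
  rw [← Prod.image_mk_segment_right, segment_eq_uIcc]
  ext ⟨u, v⟩
  simp only [Set.mem_image, Prod.mk.injEq, Set.mem_ofPred_eq]
  constructor
  · rintro ⟨y, hy, rfl, rfl⟩; exact ⟨rfl, hy⟩
  · rintro ⟨rfl, hy⟩; exact ⟨v, hy, rfl, rfl⟩

lemma segment_base (hN : (0 : ℝ) < N) (ρ : ℝ) : segment ℝ (((N : ℝ), 0) : Plane) (0, ρ) =
    {z : Plane | 0 ≤ z.1 ∧ z.1 ≤ (N : ℝ) ∧ z.2 = histBase N ρ z.1} := by
  rw [segment_eq_image']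
  ext ⟨u, v⟩
  simp only [Set.mem_image, Set.mem_Icc, Set.mem_ofPred_eq, Prod.ext_iff, Prod.fst_add,
    Prod.smul_fst, Prod.fst_sub, Prod.snd_add, Prod.smul_snd, Prod.snd_sub, smul_eq_mul, histBase]
  constructor
  · rintro ⟨t, ⟨ht0, ht1⟩, h1, h2⟩
    refine ⟨by nlinarith, by nlinarith, ?_⟩
    rw [← h1, ← h2]; field_simp; ring
  · rintro ⟨h1, h2, h3⟩
    refine ⟨(N - u) / N, ⟨div_nonneg (by linarith) hN.le, by rw [div_le_one hN]; linarith⟩, ?_, ?_⟩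
    · field_simp; ring
    · rw [h3]; field_simp; ring

lemma histPolygon_apply (i : Fin n) : histPolygon N f n i = histVertex N f i := rfl

lemma not_collinear {P Q S : Plane}
    (h : (Q.1 - P.1) * (S.2 - P.2) ≠ (Q.2 - P.2) * (S.1 - P.1)) : ¬ Collinear ℝ {P, Q, S} := by
  intro hc
  rw [collinear_iff_of_mem (p₀ := P) (by simp)] at hc
  obtain ⟨v, hv⟩ := hc
  obtain ⟨r, rfl⟩ := hv Q (by simp)
  obtain ⟨s, rfl⟩ := hv S (by simp)
  apply h
  simp
  ring

namespace IsHist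

lemma edgeSet_eq (h : IsHist N f ρ n) (i : Fin n) :
    (histPolygon N f n).edgeSet ℝ i = histEdge N f ρ i := by
  rw [Polygon.edgeSet, affineSegment_eq_segment, histPolygon_apply, histPolygon_apply,
    val_finRotate]
  have hN := h.two_le
  have hn : 2 * N + 1 ≤ n := by have := h.base; omega
  rcases h.cases_index i.isLt with ⟨j, hj, hi⟩ | ⟨j, hj, hi⟩ | hi | ⟨hi, hn', hρ⟩
  · rw [hi, if_neg (by omega), histVertex_even hj.le, histVertex_odd hj, segment_horizontal,
      histEdge_even hj, Set.uIcc_of_le (by linarith)]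
    ext z
    simp [and_assoc]
  · rw [hi, if_neg (by omega), histVertex_odd hj, show 2 * j + 1 + 1 = 2 * (j + 1) by ring,
      histVertex_even (by omega), histEdge_odd hj, Nat.cast_add_one, segment_vertical]
  · rw [hi, histVertex_even le_rfl, h.end_eq, histEdge_base, ← segment_base h.N_pos]
    rcases h.base with ⟨hn', hρ⟩ | ⟨hn', hρ, -⟩
    · rw [if_neg (by omega), histVertex_last, hρ]
    · rw [if_pos (by omega), histVertex_zero, hρ]
  · rw [hi, if_pos (by omega), histVertex_last, histVertex_zero, histEdge_last, segment_vertical,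
      Set.uIcc_of_le (h.pos 0 (by omega)).le]
    rfl

/-- Two edges of a histogram meet only if they are adjacent, and then in their common vertex. -/
lemma edge_inter (h : IsHist N f ρ n) {k l : ℕ} (hkl : k < l) (hl : l < n) {z : Plane}
    (hk : z ∈ histEdge N f ρ k) (hz : z ∈ histEdge N f ρ l) :
    (l = k + 1 ∧ z = histVertex N f l) ∨ (k = 0 ∧ l + 1 = n ∧ z = histVertex N f 0) := by
  have hN := h.two_le
  have hNpos := h.N_pos
  obtain ⟨x, y⟩ := z
  have cast_le : ∀ {p q : ℕ}, (p : ℝ) ≤ q → p ≤ q := fun h ↦ by exact_mod_cast h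
  have min_lt : ∀ {a j : ℕ}, (x = (j : ℝ) + 1) → a < N → histBase N ρ x < f a := fun hx ha ↦
    h.base_lt (by rw [hx]; positivity) ha
  rcases h.cases_index (hkl.trans hl) with ⟨i, hi, rfl⟩ | ⟨i, hi, rfl⟩ | rfl | ⟨rfl, hn', hρ⟩
  · rw [histEdge_even hi] at hk
    obtain ⟨k1, k2, k3⟩ := hk
    dsimp only at k1 k2 k3
    rcases h.cases_index hl with ⟨j, hj, rfl⟩ | ⟨j, hj, rfl⟩ | rfl | ⟨rfl, hn', hρ⟩
    · rw [histEdge_even hj] at hz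
      obtain ⟨z1, z2, z3⟩ := hz
      dsimp only at z1 z2 z3
      have hji : j ≤ i + 1 := cast_le (by push_cast; linarith)
      obtain rfl : j = i + 1 := by omega
      exact absurd (k3.symm.trans z3) (h.ne i hi)
    · rw [histEdge_odd hj] at hz
      obtain ⟨z1, z2⟩ := hz
      dsimp only at z1 z2
      have hji : j ≤ i := cast_le (by linarith)
      obtain rfl : j = i := by omega
      exact Or.inl ⟨rfl, by rw [histVertex_odd hj, z1, k3]⟩
    · rw [histEdge_base] at hz
      obtain ⟨z1, z2, z3⟩ := hz
      dsimp only at z1 z2 z3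
      have hx := h.eq_zero_of_base z1 hi (k3.symm.trans z3)
      obtain rfl : i = 0 := by
        have : i ≤ 0 := cast_le (by push_cast; linarith)
        omega
      have hfr : f 0 = ρ := by rw [← k3, z3, hx, h.base_zero]
      rcases h.base with ⟨-, hρ⟩ | ⟨hn', -⟩
      · exact absurd (hfr.trans hρ) (h.pos 0 hi).ne'
      · exact Or.inr ⟨rfl, by omega, by rw [histVertex_zero, hx, k3]⟩
    · rw [histEdge_last] at hz
      obtain ⟨z1, z2, z3⟩ := hz
      dsimp only at z1 z2 z3
      obtain rfl : i = 0 := by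
        have : i ≤ 0 := cast_le (by push_cast; linarith)
        omega
      exact Or.inr ⟨rfl, by omega, by rw [histVertex_zero, z1, k3]⟩
  · rw [histEdge_odd hi] at hk
    obtain ⟨k1, k2⟩ := hk
    dsimp only at k1 k2
    rcases h.cases_index hl with ⟨j, hj, rfl⟩ | ⟨j, hj, rfl⟩ | rfl | ⟨rfl, hn', hρ⟩
    · rw [histEdge_even hj] at hz
      obtain ⟨z1, z2, z3⟩ := hz
      dsimp only at z1 z2 z3
      have hji : j ≤ i + 1 := cast_le (by push_cast; linarith)
      obtain rfl : j = i + 1 := by omega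
      exact Or.inl ⟨by omega, by rw [histVertex_even hj.le, k1, z3, Nat.cast_add_one]⟩
    · rw [histEdge_odd hj] at hz
      obtain ⟨z1, z2⟩ := hz
      dsimp only at z1 z2
      have hji : j ≤ i := cast_le (by linarith)
      omega
    · rw [histEdge_base] at hz
      obtain ⟨z1, z2, z3⟩ := hz
      dsimp only at z1 z2 z3
      have hiN : i + 1 = N := by
        by_contra hne
        have h1 := lt_min (min_lt k1 hi) (min_lt k1 (show i + 1 < N by omega))
        exact absurd (h1.trans_le k2.1) (by rw [z3]; exact lt_irrefl _)
      have hxN : x = N := by rw [k1, ← hiN, Nat.cast_add_one]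
      exact Or.inl ⟨by omega, by
        rw [histVertex_even le_rfl, h.end_eq, z3, hxN, histBase_end]⟩
    · rw [histEdge_last] at hz
      obtain ⟨z1, -⟩ := hz
      dsimp only at z1
      have : (0 : ℝ) ≤ i := by positivity
      linarith
  · rw [histEdge_base] at hk
    obtain ⟨k1, k2, k3⟩ := hk
    dsimp only at k1 k2 k3
    rcases h.cases_index hl with ⟨j, hj, rfl⟩ | ⟨j, hj, rfl⟩ | rfl | ⟨rfl, hn', hρ⟩
    · omega
    · omega
    · omega
    · rw [histEdge_last] at hz
      obtain ⟨z1, z2, z3⟩ := hz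
      dsimp only at z1 z2 z3
      exact Or.inl ⟨rfl, by rw [histVertex_last, k3, z1, h.base_zero, hρ]⟩
  · omega

theorem isSimple (h : IsHist N f ρ n) : IsSimple (histPolygon N f n) := by
  have hN := h.two_le
  have hNpos := h.N_pos
  have hf0 := h.pos 0 (by omega)
  have hn : 2 * N + 1 ≤ n := by have := h.base; omega
  refine ⟨by omega, fun i ↦ ?_, fun i ↦ ?_, fun i j hij h1 h2 ↦ ?_⟩
  · apply not_collinear
    simp only [histPolygon_apply, val_finRotate]
    have hlt := i.isLt
    generalize (i : ℕ) = m at hlt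
    rcases h.cases_index hlt with ⟨j, hj, rfl⟩ | ⟨j, hj, rfl⟩ | rfl | ⟨rfl, hn', hρ⟩
    · rw [if_neg (show ¬ 2 * j + 1 = n by omega), if_neg (show ¬ 2 * j + 1 + 1 = n by omega),
        histVertex_even hj.le, histVertex_odd hj, show 2 * j + 1 + 1 = 2 * (j + 1) by ring,
        histVertex_even (show j + 1 ≤ N by omega)]
      simpa using sub_ne_zero.2 (h.ne j hj).symm
    · rw [if_neg (show ¬ 2 * j + 1 + 1 = n by omega), histVertex_odd hj,
        show 2 * j + 1 + 1 = 2 * (j + 1) by ring, histVertex_even (show j + 1 ≤ N by omega)]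
      rcases Nat.lt_or_ge (j + 1) N with hjN | hjN
      · rw [if_neg (show ¬ 2 * (j + 1) + 1 = n by omega), histVertex_odd hjN]
        simpa using (sub_ne_zero.2 (h.ne j hj).symm).symm
      · obtain rfl : N = j + 1 := by omega
        have hfj := h.pos j hj
        have hend := h.end_eq
        rcases h.base with ⟨hn', -⟩ | ⟨hn', -⟩
        · rw [if_neg (by omega), histVertex_last, hend]
          intro he
          push_cast at he
          nlinarith
        · rw [if_pos (by omega), histVertex_zero, hend]
          intro he
          push_cast at he
          nlinarith
    · rw [histVertex_even le_rfl, h.end_eq]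
      rcases h.base with ⟨hn', -⟩ | ⟨hn', -⟩
      · rw [if_neg (show ¬ 2 * N + 1 = n by omega), if_pos (by omega), histVertex_last,
          histVertex_zero]
        intro he
        dsimp only at he
        nlinarith
      · rw [if_pos (by omega), if_neg (by omega), histVertex_zero,
          show 0 + 1 = 2 * 0 + 1 from rfl, histVertex_odd (by omega)]
        intro he
        push_cast at he
        nlinarith
    · rw [if_pos (by omega), if_neg (by omega), histVertex_last, histVertex_zero,
        show 0 + 1 = 2 * 0 + 1 from rfl, histVertex_odd (by omega)]
      intro he
      push_cast at he
      nlinarith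
  · have key := val_finRotate i
    have hi := i.isLt
    apply Set.Subset.antisymm
    · rw [h.edgeSet_eq, h.edgeSet_eq, Set.subset_singleton_iff, histPolygon_apply]
      rintro z ⟨hz1, hz2⟩
      split_ifs at key with hc
      · rw [key] at hz2 ⊢
        rcases h.edge_inter (show 0 < (i : ℕ) by omega) hi hz2 hz1 with ⟨h3, -⟩ | ⟨-, -, h3⟩
        · omega
        · exact h3
      · rw [key] at hz2 ⊢
        rcases h.edge_inter (show (i : ℕ) < i + 1 by omega) (by omega) hz1 hz2 with
          ⟨-, h3⟩ | ⟨h3, h4, -⟩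
        · exact h3
        · omega
    · rw [Set.singleton_subset_iff]
      simp only [Polygon.edgeSet, affineSegment_eq_segment]
      exact ⟨right_mem_segment ℝ _ _, left_mem_segment ℝ _ _⟩
  · rw [Set.disjoint_left]
    intro z hz1 hz2
    rw [h.edgeSet_eq] at hz1 hz2
    have h1' := mt Fin.ext_iff.2 h1
    have h2' := mt Fin.ext_iff.2 h2
    rw [val_finRotate] at h1' h2'
    have hi := i.isLt
    have hj := j.isLt
    rcases lt_or_gt_of_ne (mt Fin.ext_iff.2 hij) with hlt | hlt
    · rcases h.edge_inter hlt hj hz1 hz2 with ⟨h3, -⟩ | ⟨h3, h4, -⟩ <;>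
        split_ifs at h1' h2' <;> omega
    · rcases h.edge_inter hlt hi hz2 hz1 with ⟨h3, -⟩ | ⟨h3, h4, -⟩ <;>
        split_ifs at h1' h2' <;> omega

end IsHist

end

/-! ### The region of a histogram polygon -/

section

variable {N n : ℕ} {f : ℕ → ℝ} {ρ : ℝ}

lemma continuous_histBase (N : ℕ) (ρ : ℝ) : Continuous (histBase N ρ) := by
  unfold histBase; fun_prop

lemma isClosed_histRegion : IsClosed (histRegion N f ρ) := by
  have hb := continuous_histBase N ρ
  have : histRegion N f ρ = {z : Plane | histBase N ρ z.1 ≤ z.2} ∩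
      ⋃ j ∈ Finset.range N, {z : Plane | (j : ℝ) ≤ z.1 ∧ z.1 ≤ (j : ℝ) + 1 ∧ z.2 ≤ f j} := by
    ext z; simp [histRegion, and_left_comm]
  rw [this]
  refine (isClosed_le (by fun_prop) (by fun_prop)).inter (isClosed_biUnion_finset fun j _ ↦ ?_)
  exact (isClosed_le continuous_const continuous_fst).inter
    ((isClosed_le continuous_fst continuous_const).inter
      (isClosed_le continuous_snd continuous_const))

lemma isOpen_histInterior : IsOpen (histInterior N f ρ) := by
  have hb := continuous_histBase N ρ
  have : histInterior N f ρ = ({z : Plane | 0 < z.1} ∩ {z | z.1 < (N : ℝ)} ∩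
      {z | histBase N ρ z.1 < z.2}) ∩ ⋂ j ∈ Finset.range N,
        ({z : Plane | z.1 < (j : ℝ)} ∪ ({z | (j : ℝ) + 1 < z.1} ∪ {z | z.2 < f j})) := by
    ext z
    simp only [histInterior, Set.mem_ofPred_eq, Set.mem_inter_iff, Set.mem_iInter,
      Finset.mem_range, Set.mem_union, and_assoc]
    refine and_congr_right fun _ ↦ and_congr_right fun _ ↦ and_congr_right fun _ ↦
      forall₂_congr fun j _ ↦ ?_
    simp only [← not_le]
    tauto
  rw [this]
  refine (((isOpen_lt (by fun_prop) (by fun_prop)).inter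
    (isOpen_lt (by fun_prop) (by fun_prop))).inter
    (isOpen_lt (by fun_prop) (by fun_prop))).inter (isOpen_biInter_finset fun j _ ↦ ?_)
  exact (isOpen_lt (by fun_prop) (by fun_prop)).union
    ((isOpen_lt (by fun_prop) (by fun_prop)).union (isOpen_lt (by fun_prop) (by fun_prop)))

lemma histInterior_subset : histInterior N f ρ ⊆ histRegion N f ρ := by
  rintro z ⟨h1, h2, h3, h4⟩
  have hf : ⌊z.1⌋₊ < N := (Nat.floor_lt h1.le).2 h2
  exact ⟨h3.le, _, hf, Nat.floor_le h1.le, (Nat.lt_floor_add_one _).le,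
    (h4 _ hf (Nat.floor_le h1.le) (Nat.lt_floor_add_one _).le).le⟩

/-- A point from which a ray escapes is not an interior point of a polygon. -/
lemma notMem_interiorRegion_of_ray {p : Polygon Plane n} {x v : Plane} (hv : ‖v‖ = 1)
    (h : ∀ s : ℝ, 0 ≤ s → x + s • v ∉ p.boundary ℝ) : x ∉ interiorRegion p := by
  rintro ⟨-, hb⟩
  obtain ⟨B, hB⟩ := isBounded_iff_forall_norm_le.1 hb
  have hsub : (fun s : ℝ ↦ x + s • v) '' Set.Ici 0 ⊆
      connectedComponentIn (p.boundary ℝ)ᶜ x := by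
    apply IsPreconnected.subset_connectedComponentIn
    · exact isPreconnected_Ici.image _ (by fun_prop)
    · exact ⟨0, by simp, by simp⟩
    · rintro _ ⟨s, hs, rfl⟩
      exact h s hs
  have hs0 : 0 ≤ |B| + ‖x‖ + 1 := by positivity
  have h1 := hB _ (hsub ⟨|B| + ‖x‖ + 1, hs0, rfl⟩)
  have h2 := norm_sub_norm_le ((|B| + ‖x‖ + 1) • v) (-x)
  rw [norm_neg, norm_smul, hv, mul_one, Real.norm_of_nonneg hs0, sub_neg_eq_add, add_comm _ x]
    at h2
  linarith [le_abs_self B]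

namespace IsHist

lemma mem_boundary (h : IsHist N f ρ n) {z : Plane} :
    z ∈ (histPolygon N f n).boundary ℝ ↔ ∃ m < n, z ∈ histEdge N f ρ m := by
  simp only [Polygon.boundary, Set.mem_iUnion, h.edgeSet_eq]
  exact ⟨fun ⟨i, hi⟩ ↦ ⟨i, i.isLt, hi⟩, fun ⟨m, hm, hz⟩ ↦ ⟨⟨m, hm⟩, hz⟩⟩

lemma two_mul_lt (h : IsHist N f ρ n) : 2 * N < n := by have := h.base; omega

lemma boundary_subset (h : IsHist N f ρ n) :
    (histPolygon N f n).boundary ℝ ⊆ histRegion N f ρ := by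
  intro z hz
  have hN := h.two_le
  obtain ⟨m, hm, hz⟩ := h.mem_boundary.1 hz
  rcases h.cases_index hm with ⟨j, hj, rfl⟩ | ⟨j, hj, rfl⟩ | rfl | ⟨rfl, hn', hρ⟩
  · rw [histEdge_even hj] at hz
    obtain ⟨h1, h2, h3⟩ := hz
    have h0 : (0 : ℝ) ≤ j := by positivity
    exact ⟨by rw [h3]; exact (h.base_le_rho (h0.trans h1)).trans (h.rho_le hj), j, hj, h1, h2, h3.le⟩
  · rw [histEdge_odd hj] at hz
    obtain ⟨h1, h2, h3⟩ := hz
    have h0 : (0 : ℝ) ≤ j := by positivity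
    rcases Nat.lt_or_ge (j + 1) N with hjN | hjN
    · refine ⟨?_, ?_⟩
      · have hx : 0 < z.1 := by linarith
        exact (lt_min (h.base_lt hx hj) (h.base_lt hx hjN)).le.trans h2
      · rcases le_max_iff.1 h3 with h3 | h3
        · exact ⟨j, hj, by linarith, by linarith, h3⟩
        · exact ⟨j + 1, hjN, by push_cast; linarith, by push_cast; linarith, h3⟩
    · obtain rfl : N = j + 1 := by omega
      have hp := h.pos j hj
      rw [h.end_eq] at h2 h3
      rw [max_eq_left hp.le] at h3
      rw [min_eq_right hp.le] at h2
      have hx : z.1 = ((j + 1 : ℕ) : ℝ) := by rw [h1]; push_cast; rfl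
      exact ⟨by rw [hx, histBase_end]; exact h2, j, hj, by linarith, by linarith, h3⟩
  · rw [histEdge_base] at hz
    obtain ⟨h1, h2, h3⟩ := hz
    refine ⟨h3.ge, ?_⟩
    have hle : ∀ j < N, z.2 ≤ f j := fun j hj ↦ by
      rw [h3]; exact (h.base_le_rho h1).trans (h.rho_le hj)
    rcases h2.eq_or_lt with he | hlt
    · refine ⟨N - 1, by omega, ?_, ?_, hle _ (by omega)⟩ <;>
        rw [Nat.cast_sub (by omega), he] <;> push_cast <;> linarith
    · have hf : ⌊z.1⌋₊ < N := (Nat.floor_lt h1).2 hlt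
      exact ⟨_, hf, Nat.floor_le h1, (Nat.lt_floor_add_one _).le, hle _ hf⟩
  · rw [histEdge_last] at hz
    obtain ⟨h1, h2, h3⟩ := hz
    exact ⟨by rw [h1, h.base_zero, hρ]; exact h2, 0, by omega, by simp [h1], by simp [h1], h3⟩

lemma interior_disjoint (h : IsHist N f ρ n) {z : Plane} (hz : z ∈ histInterior N f ρ) :
    z ∉ (histPolygon N f n).boundary ℝ := by
  intro hb
  obtain ⟨z1, z2, z3, z4⟩ := hz
  obtain ⟨m, hm, hz⟩ := h.mem_boundary.1 hb
  rcases h.cases_index hm with ⟨j, hj, rfl⟩ | ⟨j, hj, rfl⟩ | rfl | ⟨rfl, hn', hρ⟩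
  · rw [histEdge_even hj] at hz
    obtain ⟨h1, h2, h3⟩ := hz
    exact (z4 j hj h1 h2).ne h3
  · rw [histEdge_odd hj] at hz
    obtain ⟨h1, h2, -⟩ := hz
    have hjN : j + 1 < N := by
      have : ((j + 1 : ℕ) : ℝ) < N := by push_cast; linarith
      exact_mod_cast this
    exact absurd h2 (lt_min (z4 j hj (by linarith) (by linarith))
      (z4 (j + 1) hjN (by push_cast; linarith) (by push_cast; linarith))).not_ge
  · rw [histEdge_base] at hz
    exact z3.ne' hz.2.2
  · rw [histEdge_last] at hz
    exact z1.ne' hz.1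

lemma mem_interior_of_notMem (h : IsHist N f ρ n) {z : Plane} (hz : z ∈ histRegion N f ρ)
    (hb : z ∉ (histPolygon N f n).boundary ℝ) : z ∈ histInterior N f ρ := by
  have hN := h.two_le
  rw [h.mem_boundary] at hb
  push Not at hb
  obtain ⟨h1, i, hi, h2, h3, h4⟩ := hz
  have hn := h.two_mul_lt
  have hi0 : (0 : ℝ) ≤ i := by positivity
  have hi1 : (i : ℝ) + 1 ≤ N := by exact_mod_cast hi
  have hx0 : z.1 ≠ 0 := by
    intro hx
    obtain rfl : i = 0 := by
      have : (i : ℝ) ≤ 0 := by linarith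
      exact_mod_cast this.antisymm hi0
    rcases h.base with ⟨hn', hρ⟩ | ⟨-, hρ, -⟩
    · refine hb (2 * N + 1) (by omega) ?_
      rw [histEdge_last]
      rw [hx, h.base_zero, hρ] at h1
      exact ⟨hx, h1, h4⟩
    · refine hb (2 * 0) (by omega) ?_
      rw [histEdge_even hi]
      rw [hx, h.base_zero, hρ] at h1
      exact ⟨h2, h3, h4.antisymm h1⟩
  have hxN : z.1 ≠ N := by
    intro hx
    have hiN : N = i + 1 := by
      have h5 : (N : ℝ) ≤ (i : ℝ) + 1 := by linarith
      have h6 : N ≤ i + 1 := by exact_mod_cast h5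
      omega
    refine hb (2 * i + 1) (by omega) ?_
    rw [histEdge_odd hi]
    rw [hx, histBase_end] at h1
    have := h.end_eq
    rw [hiN] at this
    refine ⟨by rw [hx, hiN]; push_cast; rfl, ?_⟩
    rw [this]
    exact Set.mem_uIcc.2 (Or.inr ⟨h1, h4⟩)
  have hxN' : z.1 < N := lt_of_le_of_ne (by linarith) hxN
  refine ⟨lt_of_le_of_ne (by linarith) (Ne.symm hx0), hxN', lt_of_le_of_ne h1 ?_, ?_⟩
  · intro he
    refine hb (2 * N) hn ?_
    rw [histEdge_base]
    exact ⟨by linarith, hxN'.le, he.symm⟩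
  · intro j hj h5 h6
    by_contra! hle
    rcases lt_trichotomy i j with hij | rfl | hij
    · have h7 : j ≤ i + 1 := by
        have : (j : ℝ) ≤ (i : ℝ) + 1 := by linarith
        exact_mod_cast this
      obtain rfl : j = i + 1 := by omega
      refine hb (2 * i + 1) (by omega) ?_
      rw [histEdge_odd hi]
      push_cast at h5
      exact ⟨by linarith, Set.mem_uIcc.2 (Or.inr ⟨hle, h4⟩)⟩
    · refine hb (2 * i) (by omega) ?_
      rw [histEdge_even hi]
      exact ⟨h2, h3, h4.antisymm hle⟩
    · have h7 : i ≤ j + 1 := by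
        have : (i : ℝ) ≤ (j : ℝ) + 1 := by linarith
        exact_mod_cast this
      obtain rfl : i = j + 1 := by omega
      refine hb (2 * j + 1) (by omega) ?_
      rw [histEdge_odd hj]
      push_cast at h2
      exact ⟨by linarith, Set.mem_uIcc.2 (Or.inl ⟨hle, h4⟩)⟩

lemma notMem_interiorRegion (h : IsHist N f ρ n) {z : Plane} (hz : z ∉ histRegion N f ρ) :
    z ∉ interiorRegion (histPolygon N f n) := by
  have key : ∀ v : Plane, ‖v‖ = 1 → (∀ s : ℝ, 0 ≤ s → z + s • v ∉ histRegion N f ρ) →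
      z ∉ interiorRegion (histPolygon N f n) := fun v hv hs ↦
    notMem_interiorRegion_of_ray hv fun s hs0 hb ↦ hs s hs0 (h.boundary_subset hb)
  have hbd : ∀ w ∈ histRegion N f ρ, 0 ≤ w.1 ∧ w.1 ≤ N := by
    rintro w ⟨-, j, hj, h2, h3, -⟩
    have h0 : (0 : ℝ) ≤ j := by positivity
    have h1 : (j : ℝ) + 1 ≤ N := by exact_mod_cast hj
    exact ⟨by linarith, by linarith⟩
  rcases lt_or_ge z.1 0 with hx | hx
  · refine key (-1, 0) (by simp [Prod.norm_def]) fun s hs hm ↦ ?_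
    have := (hbd _ hm).1
    simp at this
    linarith
  rcases lt_or_ge (N : ℝ) z.1 with hxN | hxN
  · refine key (1, 0) (by simp [Prod.norm_def]) fun s hs hm ↦ ?_
    have := (hbd _ hm).2
    simp at this
    linarith
  rcases lt_or_ge z.2 (histBase N ρ z.1) with hy | hy
  · refine key (0, -1) (by simp [Prod.norm_def]) fun s hs hm ↦ ?_
    have := hm.1
    simp at this
    linarith
  · refine key (0, 1) (by simp [Prod.norm_def]) fun s hs hm ↦ hz ?_
    obtain ⟨-, j, hj, h1, h2, h3⟩ := hm
    simp at h1 h2 h3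
    exact ⟨hy, j, hj, h1, h2, by linarith⟩

lemma isBounded_histRegion (h : IsHist N f ρ n) :
    Bornology.IsBounded (histRegion N f ρ) := by
  have : histRegion N f ρ ⊆ ⋃ j ∈ Finset.range N, Set.Icc (0 : ℝ) N ×ˢ Set.Icc (0 : ℝ) (f j) := by
    rintro z ⟨h1, j, hj, h2, h3, h4⟩
    have h0 : (0 : ℝ) ≤ j := by positivity
    have h5 : (j : ℝ) + 1 ≤ N := by exact_mod_cast hj
    have h6 : z.1 ≤ N := by linarith
    simp only [Set.mem_iUnion, Finset.mem_range]
    exact ⟨j, hj, ⟨by linarith, h6⟩, (h.base_nonneg h6).trans h1, h4⟩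
  refine Bornology.IsBounded.subset ?_ this
  refine (Bornology.isBounded_biUnion_finset _).2 fun j _ ↦ ?_
  exact (Metric.isBounded_Icc _ _).prod (Metric.isBounded_Icc _ _)

/-- The complement of the boundary curve is the union of the open sets `histInterior` and
`(histRegion)ᶜ`, so a component that meets the first is contained in it. -/
lemma interiorRegion_eq (h : IsHist N f ρ n) :
    interiorRegion (histPolygon N f n) = histInterior N f ρ := by
  apply Set.Subset.antisymm
  · intro z hz
    by_contra hcon
    by_cases hR : z ∈ histRegion N f ρ
    · exact hcon (h.mem_interior_of_notMem hR hz.1)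
    · exact h.notMem_interiorRegion hR hz
  · intro z hz
    refine ⟨h.interior_disjoint hz, h.isBounded_histRegion.subset ?_⟩
    refine Set.Subset.trans ?_ histInterior_subset
    refine IsPreconnected.subset_left_of_subset_union isOpen_histInterior
      (isClosed_histRegion (N := N) (f := f) (ρ := ρ)).isOpen_compl ?_ ?_
      ⟨z, mem_connectedComponentIn (h.interior_disjoint hz), hz⟩
      isPreconnected_connectedComponentIn
    · exact Set.disjoint_left.2 fun w hw hw' ↦ hw' (histInterior_subset hw)
    · intro w hw
      by_cases hR : w ∈ histRegion N f ρ
      · exact Or.inl (h.mem_interior_of_notMem hR (connectedComponentIn_subset _ _ hw))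
      · exact Or.inr hR

theorem region_eq (h : IsHist N f ρ n) : region (histPolygon N f n) = histRegion N f ρ := by
  rw [region, h.interiorRegion_eq]
  apply Set.Subset.antisymm (Set.union_subset h.boundary_subset histInterior_subset)
  intro z hz
  by_cases hb : z ∈ (histPolygon N f n).boundary ℝ
  · exact Or.inl hb
  · exact Or.inr (h.mem_interior_of_notMem hz hb)

/-! ### Orthogonal histograms -/

theorem isOrthogonal (h : IsHist N f 0 (2 * N + 2)) :
    IsOrthogonal (histPolygon N f (2 * N + 2)) := by
  intro i
  rw [histPolygon_apply, histPolygon_apply, val_finRotate]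
  have hlt := i.isLt
  generalize (i : ℕ) = m at hlt
  have hN := h.two_le
  rcases h.cases_index hlt with ⟨j, hj, rfl⟩ | ⟨j, hj, rfl⟩ | rfl | ⟨rfl, -⟩
  · rw [if_neg (by omega), histVertex_even hj.le, histVertex_odd hj]
    exact Or.inr rfl
  · rw [if_neg (by omega), histVertex_odd hj, show 2 * j + 1 + 1 = 2 * (j + 1) by ring,
      histVertex_even (by omega)]
    exact Or.inl (by push_cast; rfl)
  · rw [if_neg (by omega), histVertex_even le_rfl, histVertex_last, h.end_eq]
    exact Or.inr rfl
  · rw [if_pos (by omega), histVertex_last, histVertex_zero]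
    exact Or.inl rfl

/-- A reflex vertex is a corner at the top of the lower of two adjacent columns. Its horizontal ray
points into the higher column, and its vertical ray points downwards. -/
lemma isReflex_cases (h : IsHist N f 0 (2 * N + 2)) {i : Fin (2 * N + 2)}
    (hi : IsReflex (histPolygon N f (2 * N + 2)) i) :
    ∃ j, j + 1 < N ∧
      ((histPolygon N f (2 * N + 2) i = ((j : ℝ) + 1, f j) ∧ (i : ℕ) = 2 * j + 1 ∧
        rayDirections (histPolygon N f (2 * N + 2)) i = {(0, -1), (1, 0)}) ∨
      (histPolygon N f (2 * N + 2) i = ((j : ℝ) + 1, f (j + 1)) ∧ (i : ℕ) = 2 * j + 2 ∧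
        rayDirections (histPolygon N f (2 * N + 2)) i = {(-1, 0), (0, -1)})) := by
  have hN := h.two_le
  obtain ⟨ε, hε, hε0⟩ := (hi.and self_mem_nhdsWithin).exists
  rw [h.interiorRegion_eq] at hε
  have hlt := i.isLt
  unfold rayDirections
  simp only [histPolygon_apply, val_finRotate, val_finRotate_symm] at hε ⊢
  generalize (i : ℕ) = m at hlt hε ⊢
  obtain ⟨hn, hp⟩ := hε
  rcases h.cases_index hlt with ⟨j, hj, rfl⟩ | ⟨j, hj, rfl⟩ | rfl | ⟨rfl, -⟩
  · rcases Nat.eq_zero_or_pos j with rfl | hj0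
    · rw [if_pos rfl, show 2 * N + 2 - 1 = 2 * N + 1 by omega, Nat.mul_zero, histVertex_last,
        histVertex_zero] at hp
      simpa using hp.1
    obtain ⟨j, rfl⟩ := Nat.exists_eq_succ_of_ne_zero hj0.ne'
    rw [Nat.succ_eq_add_one] at *
    rw [if_neg (by omega), show 2 * (j + 1) - 1 = 2 * j + 1 by omega, histVertex_even hj.le,
      histVertex_odd (by omega)] at hp
    obtain ⟨-, -, -, h4⟩ := hp
    have h5 := h4 (j + 1) hj (by simp) (by simp)
    simp at h5
    have hlt : f (j + 1) < f j := by nlinarith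
    refine ⟨j, hj, Or.inr ⟨by rw [histVertex_even hj.le]; push_cast; rfl, by ring, ?_⟩⟩
    rw [if_neg (by omega), if_neg (by omega), show 2 * (j + 1) - 1 = 2 * j + 1 by omega,
      histVertex_even hj.le, histVertex_odd hj, histVertex_odd (by omega)]
    simp [direction, sign_neg, hlt]
  · rw [if_neg (by omega), histVertex_odd hj, show 2 * j + 1 + 1 = 2 * (j + 1) by ring,
      histVertex_even (by omega)] at hn
    obtain ⟨-, h2, -, h4⟩ := hn
    have h5 := h4 j hj (by simp) (by simp)
    simp at h2 h5
    have hlt : f j < f (j + 1) := by nlinarith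
    have hjN : j + 1 < N := by exact_mod_cast h2
    refine ⟨j, hjN, Or.inl ⟨histVertex_odd hj, rfl, ?_⟩⟩
    rw [if_neg (by omega), if_neg (by omega), show 2 * j + 1 + 1 = 2 * (j + 1) by ring,
      show 2 * j + 1 - 1 = 2 * j by omega, histVertex_even hjN.le, histVertex_odd hj,
      histVertex_even hj.le]
    simp [direction, sign_neg, hlt]
  · rw [if_neg (by omega), show 2 * N - 1 = 2 * (N - 1) + 1 by omega, histVertex_even le_rfl,
      histVertex_odd (by omega)] at hp
    have h2 := hp.2.1
    rw [Nat.cast_sub (by omega)] at h2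
    simp at h2
  · rw [if_pos (by omega), histVertex_last, histVertex_zero] at hn
    simpa using hn.1

/-- Two reflex vertices on the same side of their walls are not joined by a horizontal chord,
because the top of the column of one of them is in the way. -/
theorem inGeneralPosition (h : IsHist N f 0 (2 * N + 2)) :
    InGeneralPosition (histPolygon N f (2 * N + 2)) := by
  intro i j hij hi hj hxy hseg
  rw [h.interiorRegion_eq] at hseg
  obtain ⟨a, ha, hA⟩ := h.isReflex_cases hi
  obtain ⟨b, hb, hB⟩ := h.isReflex_cases hj
  have hne : (i : ℕ) ≠ j := fun h' ↦ hij (Fin.ext h')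
  -- The chord from `(a + 1, y)` to `(b + 1, y)` contains a point over each column between them.
  have key : ∀ (a b c : ℕ) (y : ℝ), a < b → a ≤ c → c < b → c + 1 < N → f (c + 1) = y →
      ¬ openSegment ℝ (((a : ℝ) + 1, y) : Plane) ((b : ℝ) + 1, y) ⊆ histInterior N f 0 := by
    intro a b c y hab hac hcb hcN hy hsub
    have hac' : (a : ℝ) ≤ c := by exact_mod_cast hac
    have hcb' : (c : ℝ) + 1 ≤ b := by exact_mod_cast hcb
    have hm : ((c : ℝ) + 3 / 2, y) ∈ openSegment ℝ (((a : ℝ) + 1, y) : Plane) ((b : ℝ) + 1, y) := by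
      rw [← Prod.image_mk_openSegment_left, openSegment_eq_Ioo (by linarith)]
      exact ⟨_, ⟨by linarith, by linarith⟩, rfl⟩
    have h4 := (hsub hm).2.2.2 (c + 1) hcN (by push_cast; linarith) (by push_cast; linarith)
    simp only at h4
    linarith
  have three : ({(0, -1), (1, 0)} ∪ {(-1, 0), (0, -1)} : Set (SignType × SignType)).ncard = 3 := by
    have : ({(0, -1), (1, 0)} ∪ {(-1, 0), (0, -1)} : Set (SignType × SignType)) =
        (({(0, -1), (1, 0), (-1, 0)} : Finset (SignType × SignType)) : Set _) := by
      ext x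
      simp
      tauto
    rw [this, Set.ncard_coe_finset]
    decide
  rcases hA with ⟨pa, ia, ra⟩ | ⟨pa, ia, ra⟩ <;> rcases hB with ⟨pb, ib, rb⟩ | ⟨pb, ib, rb⟩
  · exfalso
    rw [pa, pb] at hxy hseg
    have hab : a ≠ b := by omega
    have hy : f a = f b := hxy.resolve_left fun h' ↦ hab (by simpa using h')
    rcases lt_or_gt_of_ne hab with hlt | hlt
    · obtain ⟨b, rfl⟩ := Nat.exists_eq_succ_of_ne_zero (by omega : b ≠ 0)
      rw [hy] at hseg
      exact key a (b + 1) b _ hlt (by omega) (by omega) (by omega) rfl hseg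
    · obtain ⟨a, rfl⟩ := Nat.exists_eq_succ_of_ne_zero (by omega : a ≠ 0)
      rw [← hy, openSegment_symm] at hseg
      exact key b (a + 1) a _ hlt (by omega) (by omega) (by omega) rfl hseg
  · rw [ra, rb, three]
  · rw [ra, rb, Set.union_comm, three]
  · exfalso
    rw [pa, pb] at hxy hseg
    have hab : a ≠ b := by omega
    have hy : f (a + 1) = f (b + 1) := hxy.resolve_left fun h' ↦ hab (by simpa using h')
    rcases lt_or_gt_of_ne hab with hlt | hlt
    · rw [← hy] at hseg
      exact key a b a _ hlt le_rfl hlt ha rfl hseg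
    · rw [hy, openSegment_symm] at hseg
      exact key b a b _ hlt le_rfl hlt hb rfl hseg

end IsHist

end

/-! ### Nested histograms -/

/-- The number of rows of a nest of depth `k` through which the column over `[j, j + 1]` extends:
it crosses the row `i` unless it is a gap between blocks of level `i`, that is, unless `j` is a
multiple of `4 ^ (k - i)`. The columns outside of `[0, 4 ^ k]` do not reach the nest. -/
def rank (k j : ℕ) : ℕ :=
  if j < 4 ^ k then (Finset.range k).sup fun i ↦ if 4 ^ (k - i) ∣ j then 0 else i + 1 else 0

/-- The column heights of a nested histogram with `N` columns. The first column is the lowest one.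
Subtracting the parity of `j` makes adjacent columns differ in height, also where both belong to
one block of the last level or lie outside of the nest. -/
noncomputable def nestHeight (k N j : ℕ) : ℝ :=
  if N ≤ j then 0 else if j = 0 then 1 else level k (rank k j) - (j % 2 : ℕ)

lemma rank_le {k i j : ℕ} (h : 4 ^ (k - i) ∣ j) : rank k j ≤ i := by
  unfold rank
  split_ifs
  · refine Finset.sup_le fun l _ ↦ ?_
    split_ifs with hl
    · exact Nat.zero_le i
    · by_contra! hlt
      exact hl ((pow_dvd_pow 4 (by omega)).trans h)
  · exact Nat.zero_le i

lemma lt_rank {k i j : ℕ} (hi : i < k) (hj : j < 4 ^ k) (h : ¬ 4 ^ (k - i) ∣ j) :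
    i < rank k j := by
  unfold rank
  rw [if_pos hj]
  have := Finset.le_sup (f := fun i ↦ if 4 ^ (k - i) ∣ j then 0 else i + 1) (Finset.mem_range.2 hi)
  simpa [h] using this

lemma lt_of_lt_rank {k i j : ℕ} (h : i < rank k j) : j < 4 ^ k := by
  by_contra hj
  simp [rank, hj] at h

lemma nestHeight_zero {k N : ℕ} (hN : 0 < N) : nestHeight k N 0 = 1 := by
  simp [nestHeight, hN.ne']

lemma nestHeight_of_pos {k N j : ℕ} (hj : 0 < j) (hjN : j < N) :
    nestHeight k N j = level k (rank k j) - (j % 2 : ℕ) := by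
  rw [nestHeight, if_neg (by omega), if_neg (by omega)]

lemma three_le_nestHeight {k N j : ℕ} (hj : 0 < j) (hjN : j < N) : 3 ≤ nestHeight k N j := by
  rw [nestHeight_of_pos hj hjN]
  have h1 := four_le_level k (rank k j)
  have h2 : ((j % 2 : ℕ) : ℝ) ≤ 1 := by exact_mod_cast (by omega : j % 2 ≤ 1)
  linarith

lemma nestHeight_pos {k N j : ℕ} (hjN : j < N) : 0 < nestHeight k N j := by
  rcases Nat.eq_zero_or_pos j with rfl | hj
  · rw [nestHeight_zero hjN]; exact one_pos
  · linarith [three_le_nestHeight (k := k) hj hjN]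

lemma nestHeight_ne {k N j : ℕ} (hjN : j < N) : nestHeight k N j ≠ nestHeight k N (j + 1) := by
  rcases Nat.lt_or_ge (j + 1) N with hlt | hge
  · rcases Nat.eq_zero_or_pos j with rfl | hj
    · rw [nestHeight_zero hjN]
      have h3 := three_le_nestHeight (k := k) one_pos hlt
      rw [zero_add]
      intro he
      linarith
    · rw [nestHeight_of_pos hj hjN, nestHeight_of_pos (by omega) hlt]
      intro he
      have h1 : (4 * (8 * 4 ^ k) ^ rank k j : ℝ) + ((j + 1) % 2 : ℕ) =
          4 * (8 * 4 ^ k) ^ rank k (j + 1) + (j % 2 : ℕ) := by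
        unfold level at he
        linarith
      have h2 : 4 * (8 * 4 ^ k) ^ rank k j + (j + 1) % 2 =
          4 * (8 * 4 ^ k) ^ rank k (j + 1) + j % 2 := by exact_mod_cast h1
      omega
  · have h0 : nestHeight k N (j + 1) = 0 := by rw [nestHeight, if_pos hge]
    rw [h0]
    exact (nestHeight_pos hjN).ne'

lemma isHist_even {k N : ℕ} (hN : 2 ≤ N) : IsHist N (nestHeight k N) 0 (2 * N + 2) where
  two_le := hN
  end_eq := by simp [nestHeight]
  pos _ hj := nestHeight_pos hj
  ne _ hj := nestHeight_ne hj
  base := Or.inl ⟨rfl, rfl⟩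

lemma isHist_odd {k N : ℕ} (hN : 2 ≤ N) : IsHist N (nestHeight k N) 1 (2 * N + 1) where
  two_le := hN
  end_eq := by simp [nestHeight]
  pos _ hj := nestHeight_pos hj
  ne _ hj := nestHeight_ne hj
  base := Or.inr ⟨rfl, (nestHeight_zero (by omega)).symm, fun j hj hj1 ↦ by
    rw [nestHeight_zero (by omega)]
    linarith [three_le_nestHeight (k := k) hj1 hj]⟩

lemma convex_histBase_le (N : ℕ) (ρ : ℝ) : Convex ℝ {z : Plane | histBase N ρ z.1 ≤ z.2} := by
  intro z hz w hw a b ha hb hab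
  rw [Set.mem_ofPred_eq] at hz hw
  have : histBase N ρ (a * z.1 + b * w.1) = a * histBase N ρ z.1 + b * histBase N ρ w.1 := by
    unfold histBase
    have h : (N : ℝ) = a * N + b * N := by rw [← add_mul, hab, one_mul]
    have h' : ρ * (N - (a * z.1 + b * w.1)) = a * (ρ * (N - z.1)) + b * (ρ * (N - w.1)) := by
      linear_combination ρ * h
    rw [h']; ring
  show histBase N ρ (a * z.1 + b * w.1) ≤ a * z.2 + b * w.2
  rw [this]
  exact add_le_add (mul_le_mul_of_nonneg_left hz ha) (mul_le_mul_of_nonneg_left hw hb)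

/-- The region of a nested histogram is a nest over the half-plane above its base. -/
theorem IsHist.isNest {k N n : ℕ} {ρ : ℝ} (h : IsHist N (nestHeight k N) ρ n)
    (hN : 4 ^ k ≤ N) :
    IsNest k {z | histBase N ρ z.1 ≤ z.2} (histRegion N (nestHeight k N) ρ) where
  convex := convex_histBase_le N ρ
  subset _ hz := hz.1
  mem_base z hx hy := by
    have h0 := hx.1
    simp at h0
    have h2 := h.rho_le (show 0 < N by have := h.two_le; omega)
    rw [nestHeight_zero (by have := h.two_le; omega)] at h2
    show histBase N ρ z.1 ≤ z.2
    linarith [h.base_le_rho (show 0 ≤ z.1 by linarith)]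
  nonneg := by
    rintro z ⟨h1, j, hj, -, h3, -⟩
    have : (j : ℝ) + 1 ≤ N := by exact_mod_cast hj
    exact (h.base_nonneg (by linarith)).trans h1
  narrow := by
    rintro z ⟨-, j, hj, h2, h3, h4⟩ i hi hlev
    have h5 : i < rank k j := by
      by_contra! hle
      rcases Nat.eq_zero_or_pos j with rfl | hj0
      · rw [nestHeight_zero hj] at h4
        linarith [four_le_level k i]
      · rw [nestHeight_of_pos hj0 hj] at h4
        have : (0 : ℝ) ≤ (j % 2 : ℕ) := by positivity
        linarith [level_mono k hle]
    have hj4 := lt_of_lt_rank h5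
    have hdvd : ¬ 4 ^ (k - i) ∣ j := fun hd ↦ absurd h5 (rank_le hd).not_gt
    have hmod := Nat.div_add_mod j (4 ^ (k - i))
    have hmod0 : j % 4 ^ (k - i) ≠ 0 := fun h0 ↦ hdvd (Nat.dvd_of_mod_eq_zero h0)
    have hmodlt := Nat.mod_lt j (show 4 ^ (k - i) > 0 by positivity)
    refine ⟨j / 4 ^ (k - i), ?_, ?_, ?_⟩
    · rw [Nat.div_lt_iff_lt_mul (by positivity), ← pow_add]
      rwa [Nat.add_sub_cancel' hi.le]
    · have : 4 ^ (k - i) * (j / 4 ^ (k - i)) + 1 ≤ j := by omega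
      have : (4 : ℝ) ^ (k - i) * ((j / 4 ^ (k - i) : ℕ) : ℝ) + 1 ≤ j := by exact_mod_cast this
      linarith
    · have : j + 1 ≤ 4 ^ (k - i) * (j / 4 ^ (k - i) + 1) := by rw [mul_add]; omega
      have : (j : ℝ) + 1 ≤ (4 : ℝ) ^ (k - i) * (((j / 4 ^ (k - i) : ℕ) : ℝ) + 1) := by
        exact_mod_cast this
      linarith
  wide := by
    rintro z hz i q hi hq ⟨h1, h2⟩ h3
    -- The column of the block that contains `z`.
    obtain ⟨j, hj1, hj2, hj3, hj4⟩ : ∃ j : ℕ, 4 ^ (k - i) * q + 1 ≤ j ∧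
        j + 1 ≤ 4 ^ (k - i) * (q + 1) ∧ (j : ℝ) ≤ z.1 ∧ z.1 ≤ j + 1 := by
      have hx0 : 0 ≤ z.1 := le_trans (by positivity) h1
      rcases h2.eq_or_lt with he | hlt
      · have h4 : 4 ^ 1 ≤ 4 ^ (k - i) := Nat.pow_le_pow_right (by norm_num) (by omega)
        have hpos : 1 ≤ 4 ^ (k - i) * (q + 1) := Nat.mul_pos (by positivity) (by omega)
        have hc : ((4 ^ (k - i) * (q + 1) - 1 : ℕ) : ℝ) = 4 ^ (k - i) * ((q : ℝ) + 1) - 1 := by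
          push_cast [Nat.cast_sub hpos]; ring
        refine ⟨4 ^ (k - i) * (q + 1) - 1, ?_, by omega, ?_, ?_⟩
        · rw [mul_add, mul_one]; omega
        · rw [hc, he]; linarith
        · rw [hc, he]; linarith
      · refine ⟨⌊z.1⌋₊, Nat.le_floor ?_, ?_, Nat.floor_le hx0, (Nat.lt_floor_add_one _).le⟩
        · push_cast; exact h1
        · apply Nat.succ_le_of_lt
          rw [Nat.floor_lt hx0]
          push_cast; exact hlt
    have hjk : j < 4 ^ k := by
      have h4 : 4 ^ (k - i) * (q + 1) ≤ 4 ^ (k - i) * 4 ^ i := Nat.mul_le_mul_left _ hq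
      rw [← pow_add, Nat.sub_add_cancel (by omega)] at h4
      omega
    have hdvd : ¬ 4 ^ (k - i) ∣ j := by
      rintro ⟨m, rfl⟩
      have h5 : q < m := Nat.lt_of_mul_lt_mul_left (show 4 ^ (k - i) * q < 4 ^ (k - i) * m by omega)
      have h6 : m < q + 1 :=
        Nat.lt_of_mul_lt_mul_left (show 4 ^ (k - i) * m < 4 ^ (k - i) * (q + 1) by omega)
      omega
    refine ⟨hz, j, by omega, hj3, hj4, h3.trans ?_⟩
    rw [nestHeight_of_pos (by omega) (by omega)]
    rcases Nat.mod_two_eq_zero_or_one j with hm | hm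
    · rw [hm, Nat.cast_zero, sub_zero]
      exact level_mono k (lt_rank (by omega) hjk hdvd)
    · -- A column of odd index is no gap, so it extends beyond the row `i + 1`.
      have hdvd' : ¬ 4 ^ (k - (i + 1)) ∣ j := by
        intro hd
        have h2 : 2 ∣ j := (dvd_pow (by norm_num : 2 ∣ 4) (by omega)).trans hd
        omega
      have h5 := level_mono k (lt_rank hi hjk hdvd' : i + 2 ≤ rank k j)
      have h6 := level_succ k (i + 1)
      rw [hm, Nat.cast_one]
      nlinarith [four_le_level k (i + 1), one_le_four_pow k]

/-! ### The growth of the bound -/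

lemma lt_chiCF_of_isHist {k N n T : ℕ} {ρ : ℝ} (h : IsHist N (nestHeight k N) ρ n)
    (hk : depth T T < k) (hN : 4 ^ k ≤ N) :
    ((T + 1 : ℕ) : ℕ∞) ≤ chiCF (region (histPolygon N (nestHeight k N) n)) := by
  rw [h.region_eq]
  exact (h.isNest hN).lt_chiCF hk

lemma le_chiCFMax {C : (n : ℕ) → Set (Polygon Plane n)} {n : ℕ} {p : Polygon Plane n}
    (hp : p ∈ C n) : chiCF (region p) ≤ chiCFMax C n :=
  le_iSup₂ (f := fun (p : Polygon Plane n) (_ : p ∈ C n) ↦ chiCF (region p)) p hp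

lemma chiCFMax_mono {C D : (n : ℕ) → Set (Polygon Plane n)} {n : ℕ} (h : C n ⊆ D n) :
    chiCFMax C n ≤ chiCFMax D n :=
  iSup₂_le fun _ hp ↦ le_chiCFMax (h hp)

lemma le_chiCFMax_general {T n : ℕ} (hn : Even n) (hT : 4 * 4 ^ (depth T T + 1) ≤ n) :
    ((T + 1 : ℕ) : ℕ∞) ≤ chiCFMax generalOrthogonalPolygons n := by
  have h16 : 4 ^ 1 ≤ 4 ^ (depth T T + 1) := Nat.pow_le_pow_right (by norm_num) (by omega)
  obtain ⟨N, rfl⟩ : ∃ N, n = 2 * N + 2 := by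
    obtain ⟨m, rfl⟩ := hn
    exact ⟨m - 1, by omega⟩
  have h := isHist_even (k := depth T T + 1) (show 2 ≤ N by omega)
  exact (lt_chiCF_of_isHist h (Nat.lt_succ_self _) (by omega)).trans
    (le_chiCFMax ⟨h.isSimple, h.isOrthogonal, h.inGeneralPosition⟩)

lemma le_chiCFMax_simple {T n : ℕ} (hT : 4 * 4 ^ (depth T T + 1) ≤ n) :
    ((T + 1 : ℕ) : ℕ∞) ≤ chiCFMax simplePolygons n := by
  rcases Nat.even_or_odd n with hn | ⟨N, rfl⟩
  · exact (le_chiCFMax_general hn hT).trans (chiCFMax_mono fun p hp ↦ hp.1)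
  · have h16 : 4 ^ 1 ≤ 4 ^ (depth T T + 1) := Nat.pow_le_pow_right (by norm_num) (by omega)
    have h := isHist_odd (k := depth T T + 1) (show 2 ≤ N by omega)
    exact (lt_chiCF_of_isHist h (Nat.lt_succ_self _) (by omega)).trans (le_chiCFMax h.isSimple)

lemma depth_le (T s : ℕ) : depth T s ≤ 2 * (4 * (T + 1)) ^ s := by
  induction s with
  | zero => simp [depth]
  | succ s ih =>
    have h := depth_pos T s
    have hd : depth T (s + 1) = 2 * T * (depth T s + 1) + 2 := rfl
    calc depth T (s + 1) ≤ 4 * (T + 1) * depth T s := by rw [hd]; nlinarith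
      _ ≤ 4 * (T + 1) * (2 * (4 * (T + 1)) ^ s) := Nat.mul_le_mul_left _ ih
      _ = 2 * (4 * (T + 1)) ^ (s + 1) := by ring

/-- With `z = log (log n)`, up to `z / (4 * log z)` colors the nest fits into `n` vertices: since
`(4 * (T + 1)) ^ T ≤ (z ^ 2) ^ T ≤ exp (z / 2)`, its depth is small against `exp z = log n`. -/
lemma four_mul_four_pow_le {n T : ℕ} {z : ℝ} (hn : 1 < n) (hz : z = Real.log (Real.log n))
    (hz6 : 6 ≤ z) (hT : T ≤ 1 / 4 * (z / Real.log z)) : 4 * 4 ^ (depth T T + 1) ≤ n := by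
  have hexp : Real.exp (Real.exp z) = n := by
    have hn' : (1 : ℝ) < n := by exact_mod_cast hn
    rw [hz, Real.exp_log (Real.log_pos hn'), Real.exp_log (by linarith)]
  have he := Real.exp_one_gt_d9
  have he' := Real.exp_one_lt_d9
  have hlog : 1 ≤ Real.log z := by
    rw [Real.le_log_iff_exp_le (by linarith)]
    linarith
  have hTlog : (T : ℝ) * (2 * Real.log z) ≤ z / 2 := by
    have := mul_le_mul_of_nonneg_right hT (show 0 ≤ 2 * Real.log z by linarith)
    calc (T : ℝ) * (2 * Real.log z) ≤ 1 / 4 * (z / Real.log z) * (2 * Real.log z) := this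
      _ = z / 2 := by field_simp; ring
  have hTz : (T : ℝ) ≤ z / 4 := by nlinarith [show (0 : ℝ) ≤ T by positivity]
  have hpow : ((4 * (T + 1)) ^ T : ℝ) ≤ Real.exp (z / 2) := by
    have h1 : (4 * ((T : ℝ) + 1)) ≤ Real.exp (2 * Real.log z) := by
      rw [two_mul, Real.exp_add, Real.exp_log (by linarith)]
      nlinarith
    calc ((4 * (T + 1)) ^ T : ℝ) ≤ Real.exp (2 * Real.log z) ^ T :=
          pow_le_pow_left₀ (by positivity) h1 T
      _ = Real.exp (T * (2 * Real.log z)) := (Real.exp_nat_mul _ T).symm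
      _ ≤ Real.exp (z / 2) := Real.exp_le_exp.2 hTlog
  have hdepth : (depth T T : ℝ) ≤ 2 * Real.exp (z / 2) := by
    have : (depth T T : ℝ) ≤ 2 * (4 * (T + 1)) ^ T := by exact_mod_cast depth_le T T
    linarith
  have hE : 4 + 4 * Real.exp (z / 2) ≤ Real.exp z := by
    have h1 : Real.exp z = Real.exp (z / 2) * Real.exp (z / 2) := by
      rw [← Real.exp_add]; congr 1; ring
    have h2 : Real.exp 1 ^ 3 ≤ Real.exp (z / 2) := by
      rw [← Real.exp_nat_mul]
      exact Real.exp_le_exp.2 (by push_cast; linarith)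
    have h3 : (8 : ℝ) ≤ Real.exp 1 ^ 3 := by
      calc (8 : ℝ) = 2 ^ 3 := by norm_num
        _ ≤ Real.exp 1 ^ 3 := pow_le_pow_left₀ (by norm_num) (by linarith) 3
    nlinarith
  have h4 : (4 : ℝ) ≤ Real.exp 2 := by
    have : Real.exp 2 = Real.exp 1 * Real.exp 1 := by rw [← Real.exp_add]; norm_num
    nlinarith
  have hmain : (4 : ℝ) ^ (depth T T + 2) ≤ n := by
    calc (4 : ℝ) ^ (depth T T + 2) ≤ Real.exp 2 ^ (depth T T + 2) :=
          pow_le_pow_left₀ (by norm_num) h4 _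
      _ = Real.exp ((depth T T + 2 : ℕ) * 2) := (Real.exp_nat_mul _ _).symm
      _ ≤ Real.exp (Real.exp z) := Real.exp_le_exp.2 (by push_cast; linarith)
      _ = n := hexp
  have : 4 ^ (depth T T + 2) ≤ n := by exact_mod_cast hmain
  calc 4 * 4 ^ (depth T T + 1) = 4 ^ (depth T T + 2) := by ring
    _ ≤ n := this

lemma ofReal_le_of_natCast_le {x : ℝ} {m : ℕ∞} (h : ((⌊x⌋₊ + 1 : ℕ) : ℕ∞) ≤ m) :
    ENNReal.ofReal x ≤ (m : ℝ≥0∞) := by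
  calc ENNReal.ofReal x ≤ ENNReal.ofReal ((⌊x⌋₊ + 1 : ℕ) : ℝ) := by
        apply ENNReal.ofReal_le_ofReal
        push_cast
        exact (Nat.lt_floor_add_one x).le
    _ = (((⌊x⌋₊ + 1 : ℕ) : ℕ∞) : ℝ≥0∞) := by
        rw [ENNReal.ofReal_natCast, ENat.toENNReal_coe]
    _ ≤ m := ENat.toENNReal_le.2 h

end ArtGallery

theorem mainTheorem2 :
    ∃ c : ℝ, 0 < c ∧ ∀ᶠ n : ℕ in atTop,
      ENNReal.ofReal (c * (Real.log (Real.log n) / Real.log (Real.log (Real.log n)))) ≤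
          (ArtGallery.chiCFMax ArtGallery.simplePolygons n : ℝ≥0∞) ∧
      (Even n →
        ENNReal.ofReal (c * (Real.log (Real.log n) / Real.log (Real.log (Real.log n)))) ≤
            (ArtGallery.chiCFMax ArtGallery.simpleOrthogonalPolygons n : ℝ≥0∞) ∧
        ENNReal.ofReal (c * (Real.log (Real.log n) / Real.log (Real.log (Real.log n)))) ≤
            (ArtGallery.chiCFMax ArtGallery.generalOrthogonalPolygons n : ℝ≥0∞)) := by
  have hlim : Tendsto (fun n : ℕ ↦ Real.log (Real.log n)) atTop atTop :=
    Real.tendsto_log_atTop.comp (Real.tendsto_log_atTop.comp tendsto_natCast_atTop_atTop)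
  refine ⟨1 / 4, by norm_num, ?_⟩
  filter_upwards [hlim.eventually_ge_atTop 6, eventually_gt_atTop 1] with n hz hn
  set z := Real.log (Real.log n) with hzdef
  have hlog : 0 ≤ Real.log z := Real.log_nonneg (by linarith)
  have hT := ArtGallery.four_mul_four_pow_le (T := ⌊1 / 4 * (z / Real.log z)⌋₊) hn hzdef hz
    (Nat.floor_le (by positivity))
  refine ⟨ArtGallery.ofReal_le_of_natCast_le (ArtGallery.le_chiCFMax_simple hT), fun heven ↦ ?_⟩
  have h := ArtGallery.le_chiCFMax_general heven hT
  exact ⟨ArtGallery.ofReal_le_of_natCast_le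
    (h.trans (ArtGallery.chiCFMax_mono fun p hp ↦ ⟨hp.1, hp.2.1⟩)),
    ArtGallery.ofReal_le_of_natCast_le h⟩
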